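/- Let $A\in\mathbb R^{n\times n}$ be symmetric and nonsingular with largest and smallest eigenvalues $\alpha_1>\alpha_n$, let $0\ne g\in\mathbb R^n$, $\Delta>0$, and $q(s)=g^Ts+\tfrac12 s^TAs$; $\|\cdot\|$ is the 2-norm of a vector or matrix. Let $s_{opt}$ be a solution of $\min_{\|s\|\le\Delta}q(s)$ with $\|s_{opt}\|=\Delta$, and let $\lambda_{opt}\ge 0$ be its optimal Lagrangian multiplier, i.e. $(A+\lambda_{opt}I)s_{opt}=-g$, $\lambda_{opt}(\Delta-\|s_{opt}\|)=0$ and $A+\lambda_{opt}I\succeq 0$. Assume the easy case, i.e. it is not true that both $\lambda_{opt}=-\alpha_n$ and $g\perp\mathcal N(A-\alpha_nI)$. Let $k\ge 0$ be such that $\mathcal S_k=\mathrm{span}\{g,Ag,\dots,A^kg\}$ has dimension $k+1$, let the columns of $Q_k\in\mathbb R^{n\times(k+1)}$ be an orthonormal basis of $\mathcal S_k$ (for example the Lanczos basis), and let $s_k$ be a solution of $\min_{s\in\mathcal S_k,\ \|s\|\le\Delta}q(s)$ with $\|s_k\|=\Delta$. Put $$M=\begin{pmatrix}-A& gg^T/\Delta^2\\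 I&-A\end{pmatrix},\qquad M_k=\widetilde Q_k^TM\widetilde Q_k,\qquad \widetilde Q_k=\begin{pmatrix}Q_k&0\\0&Q_k\end{pmatrix}.$$ Let $\mu_1\in\mathbb R$ and $\mu_1^{(k)}\in\mathbb R$ be the rightmost eigenvalues (those of largest real part) of $M$ and $M_k$, with real unit length eigenvectors $y$ and $z^{(k)}$ respectively. Let the columns of $Z_\perp$ be an orthonormal basis of the orthogonal complement of $z^{(k)}$, and let $C_k=Z_\perp^TM_kZ_\perp$. Let $\mathrm{sep}(\mu_1,C_k)=\|(C_k-\mu_1I)^{-1}\|^{-1}$, which is understood as $0$ if $C_k-\mu_1I$ is singular. Let $\varepsilon_k=\sin\angle(y,\mathcal S_k\oplus\mathcal S_k)$ be the distance of $y$ from $\mathcal S_k\oplus\mathcal S_k\subset\mathbb R^{2n}$. Put $$\kappa=\frac{\alpha_1+\lambda_{opt}}{\alpha_n+\lambda_{opt}},\quad t=\frac{\sqrt\kappa-1}{\sqrt\kappa+1},\quad c_k=2+\frac{16(\alpha_1+\lambda_{opt})}{(\alpha_1-\alpha_n)^2(1-t^2)}\Bigl(1+\frac{k+2}{|\ln t|}\Bigr)t^2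 .$$ If $\mathrm{sep}(\mu_1,C_k)>0$, then $$\sin\angle(s_k,s_{opt})\le c_k\Bigl(1+\frac{\|M\|}{\sqrt{1-\varepsilon_k^2}\;\mathrm{sep}(\mu_1,C_k)}\Bigr)\Bigl(\frac{\sqrt\kappa-1}{\sqrt\kappa+1}\Bigr)^{k+1}.$$ -/

import Mathlib

open scoped Matrix

noncomputable section

/-- The objective `q(s) = gᵀ s + ½ sᵀ A s` of the trust-region subproblem. -/
def trsObjective {n : ℕ} (A : Matrix (Fin n) (Fin n) ℝ) (g s : EuclideanSpace ℝ (Fin n)) : ℝ :=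
  inner ℝ g s + (1 / 2) * inner ℝ s (Matrix.toEuclideanLin A s)

/-- `s` is a (global) solution of `min q(s)` over all `s ∈ K` with `‖s‖ ≤ Δ`. The subproblem itself
is the case `K = ⊤`; the projected subproblems have for `K` a Krylov subspace. -/
def IsTRSSolution {n : ℕ} (A : Matrix (Fin n) (Fin n) ℝ) (g : EuclideanSpace ℝ (Fin n)) (Δ : ℝ)
    (K : Submodule ℝ (EuclideanSpace ℝ (Fin n))) (s : EuclideanSpace ℝ (Fin n)) : Prop :=
  s ∈ K ∧ ‖s‖ ≤ Δ ∧ ∀ x ∈ K, ‖x‖ ≤ Δ → trsObjective A g s ≤ trsObjective A g x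

/-- `lam` is the optimal Lagrangian multiplier belonging to the solution `s`. -/
def IsOptimalMultiplier {n : ℕ} (A : Matrix (Fin n) (Fin n) ℝ) (g : EuclideanSpace ℝ (Fin n))
    (Δ : ℝ) (s : EuclideanSpace ℝ (Fin n)) (lam : ℝ) : Prop :=
  0 ≤ lam ∧ Matrix.toEuclideanLin (A + lam • (1 : Matrix (Fin n) (Fin n) ℝ)) s = -g ∧
    lam * (Δ - ‖s‖) = 0 ∧ (A + lam • (1 : Matrix (Fin n) (Fin n) ℝ)).PosSemidef

/-- The hard case, where `αmin` is the smallest eigenvalue of `A` and `lam` the optimal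
Lagrangian multiplier. -/
def HardCase {n : ℕ} (A : Matrix (Fin n) (Fin n) ℝ) (g : EuclideanSpace ℝ (Fin n))
    (αmin lam : ℝ) : Prop :=
  (∀ v : EuclideanSpace ℝ (Fin n), Matrix.toEuclideanLin A v = αmin • v → inner ℝ g v = (0 : ℝ)) ∧
    lam = -αmin

/-- The Krylov subspace `span {g, A g, …, Aᵏ g}`. -/
def krylov {n : ℕ} (A : Matrix (Fin n) (Fin n) ℝ) (g : EuclideanSpace ℝ (Fin n)) (k : ℕ) :
    Submodule ℝ (EuclideanSpace ℝ (Fin n)) :=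
  Submodule.span ℝ (Set.range fun i : Fin (k + 1) => Matrix.toEuclideanLin (A ^ (i : ℕ)) g)

/-- The augmented matrix `M = [-A, g gᵀ / Δ²; I, -A]`. -/
def augMatrix {n : ℕ} (A : Matrix (Fin n) (Fin n) ℝ) (g : EuclideanSpace ℝ (Fin n)) (Δ : ℝ) :
    Matrix (Fin n ⊕ Fin n) (Fin n ⊕ Fin n) ℝ :=
  Matrix.fromBlocks (-A) ((Δ ^ 2)⁻¹ • Matrix.vecMulVec g.ofLp g.ofLp) 1 (-A)

/-- The subspace of all `(u, v)` with `u, v ∈ S`. -/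
def doubledSubspace {n : ℕ} (S : Submodule ℝ (EuclideanSpace ℝ (Fin n))) :
    Submodule ℝ (EuclideanSpace ℝ (Fin n ⊕ Fin n)) where
  carrier := {w | WithLp.toLp 2 (fun i => w (Sum.inl i)) ∈ S ∧
    WithLp.toLp 2 (fun i => w (Sum.inr i)) ∈ S}
  zero_mem' := ⟨S.zero_mem, S.zero_mem⟩
  add_mem' := fun ha hb => ⟨S.add_mem ha.1 hb.1, S.add_mem ha.2 hb.2⟩
  smul_mem' := fun c _ ha => ⟨S.smul_mem c ha.1, S.smul_mem c ha.2⟩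

/-- The matrix with columns `v j`. -/
def colMatrix {ι κ : Type*} (v : κ → EuclideanSpace ℝ ι) : Matrix ι κ ℝ :=
  Matrix.of fun i j => v j i

/-- The projected matrix `M_k = Q̃ᵀ M Q̃` with `Q̃ = diag(Q, Q)`, `Q` having the columns `q j`. -/
def projMatrix {n m : ℕ} (M : Matrix (Fin n ⊕ Fin n) (Fin n ⊕ Fin n) ℝ)
    (q : Fin m → EuclideanSpace ℝ (Fin n)) : Matrix (Fin m ⊕ Fin m) (Fin m ⊕ Fin m) ℝ :=
  (Matrix.fromBlocks (colMatrix q) 0 0 (colMatrix q))ᵀ * M *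
    Matrix.fromBlocks (colMatrix q) 0 0 (colMatrix q)

/-- The compression `Zᵀ B Z` of `B`, where `Z` has the columns `w j`. -/
def compression {ι κ : Type*} [Fintype ι] (B : Matrix ι ι ℝ) (w : κ → EuclideanSpace ℝ ι) :
    Matrix κ κ ℝ :=
  (colMatrix w)ᵀ * B * colMatrix w

/-- The real number `μ` is the rightmost eigenvalue of the real matrix `B`: it is an eigenvalue,
and no complex eigenvalue has a larger real part. -/
def IsRightmostEigenvalue {ι : Type*} [Fintype ι] [DecidableEq ι] (B : Matrix ι ι ℝ)
    (μ : ℝ) : Prop :=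
  (μ : ℂ) ∈ spectrum ℂ (B.map Complex.ofReal) ∧
    ∀ ν ∈ spectrum ℂ (B.map Complex.ofReal), ν.re ≤ μ

/-- `y` is a unit length eigenvector of `B` for the eigenvalue `μ`. -/
def IsUnitEigenvector {ι : Type*} [Fintype ι] [DecidableEq ι] (B : Matrix ι ι ℝ) (μ : ℝ)
    (y : EuclideanSpace ℝ ι) : Prop :=
  Matrix.toEuclideanLin B y = μ • y ∧ ‖y‖ = 1

/-- The matrix 2-norm. -/
def specNorm {ι : Type*} [Fintype ι] [DecidableEq ι] (B : Matrix ι ι ℝ) : ℝ :=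
  ‖Matrix.toEuclideanCLM (n := ι) (𝕜 := ℝ) B‖

/-- The separation `sep(μ, L) = ‖(L - μ I)⁻¹‖⁻¹`. If `L - μ I` is singular then Lean's inverse of it
is `0`, so that `sep μ L = 0`, which is also the smallest singular value of `L - μ I`. -/
def sep {ι : Type*} [Fintype ι] [DecidableEq ι] (μ : ℝ) (L : Matrix ι ι ℝ) : ℝ :=
  (specNorm (L - μ • (1 : Matrix ι ι ℝ))⁻¹)⁻¹

/-- The sine of the angle between the vector `u` and the subspace `S`. -/
def sinAngleSubspace {ι : Type*} [Fintype ι] (u : EuclideanSpace ℝ ι)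
    (S : Submodule ℝ (EuclideanSpace ℝ ι)) : ℝ :=
  ‖u - S.starProjection u‖ / ‖u‖

/-- `κ = (α₁ + λ_opt) / (αₙ + λ_opt)`. -/
def trsKappa (αmax αmin lam : ℝ) : ℝ :=
  (αmax + lam) / (αmin + lam)

/-- `t = (√κ - 1) / (√κ + 1)`. -/
def trsRate (αmax αmin lam : ℝ) : ℝ :=
  (Real.sqrt (trsKappa αmax αmin lam) - 1) / (Real.sqrt (trsKappa αmax αmin lam) + 1)

/-- The factor `c_k`. -/
def trsFactor (αmax αmin lam : ℝ) (k : ℕ) : ℝ :=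
  2 + 16 * (αmax + lam) / ((αmax - αmin) ^ 2 * (1 - trsRate αmax αmin lam ^ 2)) *
    (1 + ((k : ℝ) + 2) / |Real.log (trsRate αmax αmin lam)|) * trsRate αmax αmin lam ^ 2

end

/-!
The rightmost eigenvector of the augmented matrix `M` is a multiple of `(s_opt, B⁻¹ s_opt)`, where
`B = A + λ_opt I` is positive definite in the easy case
(`augMatrix_rightmost_eigenvector`). The projected matrix `M_k` is the augmented matrix of the
trust-region subproblem projected to the Krylov space, which never has a hard case, so that the
upper block of `z` is likewise a multiple of `s_k` in the coordinates of the basis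
(`exists_upperPart_projected_eigenvector`). With `τ = t ^ (k + 1)` this gives two bounds on
the sine `σ` of the angle between `s_k` and `s_opt`.

* On the sphere, the objective differs by a constant from half the squared distance to `s_opt` in
  the energy norm of `B`. Since `s_k` is optimal, it is within the factor `√κ` of the best
  approximation, and `σ ≤ 2 √κ τ` (`sin_angle_le_of_constrained_min`).
* By the perturbation theorem for Ritz vectors (`exists_norm_sub_smul_ritzVector_le`), the line of
  the Ritz vector is within `(1 + ‖M‖ / sep)` times the distance of `y` from the doubled
  Krylov space. Chebyshev residual polynomials bound the distances of the two blocks by `2 τ` and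
  `X τ`, relative to the upper block (`exists_krylov_approx`), so that
  `σ ≤ (1 + ‖M‖ / sep) √(4 + X²) τ` (`sin_angle_le_of_ritzVector`).

The second bound alone does not yield the constant `c_k` for small `t`, where `X` may be larger
than `c_k - 2`, and the first alone does not yield it for `t` near `1`, where `√κ` is large.
But `sep ≤ 2 ‖M‖` (`sep_compression_le`), so the factor of the claim is at least `3 / 2`, and an
elementary comparison of `X` with `c_k - 2` shows that one of the two bounds always suffices
(`combine_bounds`).
-/

/-! ### Chebyshev residual polynomials -/

open Polynomial in
/-- The Chebyshev polynomial of degree `m` shifted to the interval `[w (1 - t)², w (1 + t)²]` and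
normalized to the value `1` at `0`. Every interval `[a, b]` with `0 < a < b` has this form, where
`t = (√(b/a) - 1) / (√(b/a) + 1)`, and `0` is then mapped to `cosh (-log t)`. The derivative bound
is `sinh (mθ) ≤ cosh (mθ)`. -/
lemma exists_residual_polynomial {t w : ℝ} (ht : 0 < t) (ht1 : t < 1) (hw : 0 < w) (m : ℕ) :
    ∃ R : ℝ[X], R.natDegree ≤ m ∧ R.eval 0 = 1 ∧
      (∀ x, w * (1 - t) ^ 2 ≤ x → x ≤ w * (1 + t) ^ 2 →
        |R.eval x| ≤ 2 * t ^ m / (1 + (t ^ m) ^ 2)) ∧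
      |R.derivative.eval 0| ≤ m / (w * (1 - t ^ 2)) := by
  set θ : ℝ := -Real.log t with hθ
  have hexp : Real.exp θ = t⁻¹ := by rw [hθ, Real.exp_neg, Real.exp_log ht]
  have hexp' : Real.exp (-θ) = t := by rw [hθ, neg_neg, Real.exp_log ht]
  have hcosh : Real.cosh θ = (1 + t ^ 2) / (2 * t) := by
    rw [Real.cosh_eq, hexp, hexp']; field_simp
  have hsinh : Real.sinh θ = (1 - t ^ 2) / (2 * t) := by
    rw [Real.sinh_eq, hexp, hexp']; field_simp
  have ht2 : 0 < 1 - t ^ 2 := by nlinarith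
  have hsinh_pos : 0 < Real.sinh θ := by rw [hsinh]; positivity
  set N : ℝ := (Chebyshev.T ℝ m).eval (Real.cosh θ) with hN
  have hNc : N = Real.cosh (m * θ) := by rw [hN, Chebyshev.T_real_cosh]; simp
  have hNpos : 0 < N := by rw [hNc]; exact Real.cosh_pos _
  have hNinv : N⁻¹ = 2 * t ^ m / (1 + (t ^ m) ^ 2) := by
    have h1 : Real.exp (m * θ) = (t ^ m)⁻¹ := by rw [Real.exp_nat_mul, hexp, inv_pow]
    have h2 : Real.exp (-(m * θ)) = t ^ m := by rw [Real.exp_neg, h1, inv_inv]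
    rw [hNc, Real.cosh_eq, h1, h2]
    have : 0 < t ^ m := by positivity
    field_simp
  have hU : |(Chebyshev.U ℝ (m - 1 : ℤ)).eval (Real.cosh θ)| ≤ N / Real.sinh θ := by
    rw [le_div_iff₀ hsinh_pos, ← abs_of_pos hsinh_pos, ← abs_mul, Chebyshev.U_real_cosh, hNc]
    have : (((m : ℤ) - 1 : ℤ) : ℝ) + 1 = m := by push_cast; ring
    rw [this, abs_le]
    constructor
    · have := Real.exp_pos (m * θ); rw [Real.cosh_eq, Real.sinh_eq]; linarith
    · exact (Real.sinh_lt_cosh _).le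
  refine ⟨C N⁻¹ * (Chebyshev.T ℝ m).comp (C (Real.cosh θ) - C (1 / (2 * t * w)) * X), ?_, ?_, ?_, ?_⟩
  · refine (natDegree_C_mul_le _ _).trans (natDegree_comp_le.trans ?_)
    have h1 : (Chebyshev.T ℝ (m : ℤ)).natDegree = m := by simp [Chebyshev.natDegree_T]
    have h2 : (C (Real.cosh θ) - C (1 / (2 * t * w)) * X : ℝ[X]).natDegree ≤ 1 := by
      compute_degree
    rw [h1]; nlinarith
  · simp [eval_comp, ← hN, hNpos.ne']
  · intro x hx1 hx2
    rw [eval_mul, eval_C, eval_comp, abs_mul, abs_of_pos (inv_pos.2 hNpos), ← hNinv]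
    refine mul_le_of_le_one_right (inv_pos.2 hNpos).le (Chebyshev.abs_eval_T_real_le_one _ ?_)
    have : eval x (C (Real.cosh θ) - C (1 / (2 * t * w)) * X) =
        (w * (1 + t ^ 2) - x) / (2 * t * w) := by
      simp only [eval_sub, eval_C, eval_mul, eval_X, hcosh]; field_simp
    rw [this, abs_div, abs_of_pos (by positivity : 0 < 2 * t * w), div_le_one (by positivity), abs_le]
    constructor <;> nlinarith
  · have : eval 0 (derivative (C N⁻¹ * (Chebyshev.T ℝ m).comp
        (C (Real.cosh θ) - C (1 / (2 * t * w)) * X))) =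
        -(N⁻¹ * (m * (Chebyshev.U ℝ (m - 1 : ℤ)).eval (Real.cosh θ)) * (1 / (2 * t * w))) := by
      simp [derivative_comp, Chebyshev.T_derivative_eq_U, eval_comp]
      ring
    rw [this, abs_neg, abs_mul, abs_mul, abs_mul, abs_of_pos (inv_pos.2 hNpos), Nat.abs_cast,
      abs_of_pos (by positivity : 0 < 1 / (2 * t * w))]
    calc _ ≤ N⁻¹ * (m * (N / Real.sinh θ)) * (1 / (2 * t * w)) := by gcongr
      _ = m / (w * (1 - t ^ 2)) := by rw [hsinh]; field_simp

/-! ### The scalar inequality -/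

/-- This is `x ≤ sinh x` at `x = -log √t`. -/
lemma neg_log_mul_sqrt_le {t : ℝ} (ht : 0 < t) (ht1 : t < 1) :
    -Real.log t * √t ≤ 1 - t := by
  set r := √t with hr
  have hr0 : 0 < r := Real.sqrt_pos.2 ht
  have hrt : r ^ 2 = t := Real.sq_sqrt ht.le
  have h : -Real.log r ≤ Real.sinh (-Real.log r) := by
    rw [Real.self_le_sinh_iff, neg_nonneg]
    apply Real.log_nonpos hr0.le
    nlinarith
  rw [Real.sinh_eq, neg_neg, Real.exp_neg, Real.exp_log hr0] at h
  have hl : Real.log t = 2 * Real.log r := by rw [← hrt, Real.log_pow]; norm_num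
  have : (r⁻¹ - r) / 2 * (2 * r) = 1 - t := by rw [← hrt]; field_simp
  rw [hl, ← this]
  nlinarith

/-- Comparison of the rate `X` at which a Krylov space approximates the lower block of the
eigenvector with the rate `D = c_k - 2`. Both quantities are affine in `m`, so that `m = 1` (`h2`)
and the slope (`h1`) decide. -/
lemma approx_rate_le_mul {t w m L X D ρ : ℝ} (ht : 0 < t) (ht1 : t < 1) (hw : 0 < w)
    (hL : 0 < L) (hLt : L * √t ≤ 1 - t) (hm : 1 ≤ m) (hρ : 0 ≤ ρ)
    (hX : X = 2 / w * (1 / (1 - t) ^ 2 + m / (1 - t ^ 2)))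
    (hD : D = 1 / w * ((1 + t) / (1 - t)) * (1 + (m + 1) / L))
    (h1 : 2 * (1 - t) ≤ ρ * ((1 + t) ^ 2 * √t))
    (h2 : 4 ≤ ρ * ((1 + t) ^ 2 * (1 - t + 2 * √t))) : X ≤ ρ * D := by
  have h1t : 0 < 1 - t := by linarith
  have hs : 0 < √t := Real.sqrt_pos.2 ht
  have hLi : √t / (1 - t) ≤ 1 / L := by rw [div_le_div_iff₀ h1t hL]; linarith
  have hD' : 1 / w * ((1 + t) / (1 - t)) * (1 + (m + 1) * (√t / (1 - t))) ≤ D := by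
    rw [hD, div_eq_mul_one_div (m + 1) L]
    gcongr
  refine le_trans ?_ (mul_le_mul_of_nonneg_left hD' hρ)
  have e1 : X = (2 * (1 + t) + 2 * m * (1 - t)) / (w * (1 - t) ^ 2 * (1 + t)) := by
    have : 1 - t ^ 2 = (1 - t) * (1 + t) := by ring
    rw [hX, this]; field_simp
  have e2 : ρ * (1 / w * ((1 + t) / (1 - t)) * (1 + (m + 1) * (√t / (1 - t)))) =
      (ρ * (1 + t) ^ 2 * (1 - t + (m + 1) * √t)) / (w * (1 - t) ^ 2 * (1 + t)) := by
    field_simp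
  rw [e1, e2]
  gcongr
  nlinarith [mul_nonneg (sub_nonneg.2 hm) (sub_nonneg.2 h1)]

/-- The two bounds on the sine cover all rates: `hσ1` suffices for small `t` or large `D`, and
`hσ2` suffices when `X` does not exceed `D` by too large a factor. For `t` near `1` only `hσ2` is
strong enough, for `t` near `0` only `hσ1` is. -/
lemma combine_bounds {t w m L X D F τ σ : ℝ} (ht : 0 < t) (ht1 : t < 1) (hw : 0 < w)
    (hL : 0 < L) (hLt : L * √t ≤ 1 - t) (hm : 1 ≤ m)
    (hX : X = 2 / w * (1 / (1 - t) ^ 2 + m / (1 - t ^ 2)))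
    (hD : D = 1 / w * ((1 + t) / (1 - t)) * (1 + (m + 1) / L))
    (hF : 3 / 2 ≤ F) (hτ : 0 < τ)
    (hσ1 : σ ≤ 2 * ((1 + t) / (1 - t)) * τ) (hσ2 : σ ≤ F * √(4 + X ^ 2) * τ) :
    σ ≤ (2 + D) * F * τ := by
  have h1t : 0 < 1 - t := by linarith
  have h1t2 : 0 < 1 - t ^ 2 := by nlinarith
  have hD0 : 0 < D := by rw [hD]; positivity
  have hX0 : 0 < X := by rw [hX]; positivity
  have hs0 := Real.sqrt_nonneg t
  have hs2 := Real.sq_sqrt ht.le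
  -- `F ≥ 3 / 2` turns `hσ1` into the claim as soon as `√κ = (1 + t) / (1 - t)` is small enough
  have way1 : 2 * (1 + t) ≤ (2 + D) * (3 / 2) * (1 - t) → σ ≤ (2 + D) * F * τ := by
    intro h
    refine hσ1.trans (mul_le_mul_of_nonneg_right ?_ hτ.le)
    rw [← mul_div_assoc]
    refine (div_le_iff₀ h1t).2 h |>.trans ?_
    gcongr
  -- `4 + X ^ 2 ≤ (2 + D) ^ 2` follows from `X ≤ ρ * D` and `(ρ ^ 2 - 1) * D ≤ 4`
  have way2 : ∀ ρ : ℝ, 0 ≤ ρ → X ≤ ρ * D → (ρ ^ 2 - 1) * D ≤ 4 → σ ≤ (2 + D) * F * τ := by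
    intro ρ hρ h h'
    refine hσ2.trans (mul_le_mul_of_nonneg_right ?_ hτ.le)
    rw [mul_comm]
    refine mul_le_mul_of_nonneg_right ?_ (by linarith)
    rw [Real.sqrt_le_left (by linarith)]
    nlinarith [mul_le_mul h h hX0.le (by positivity), mul_le_mul_of_nonneg_left h' hD0.le]
  have hs1 : √t ≤ 1 := Real.sqrt_le_one.2 ht1.le
  -- the hypotheses of the comparison, from lower bounds `c` and `d` of `1 + t` and `√t`
  have key : ∀ ρ c d : ℝ, 0 ≤ ρ → 0 ≤ c → 0 ≤ d → c ≤ 1 + t → d ≤ √t →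
      2 * (1 - t) ≤ ρ * (c ^ 2 * d) → 4 ≤ ρ * (c ^ 2 * (1 + 2 * d - d ^ 2)) → X ≤ ρ * D := by
    intro ρ c d hρ hc hd hct hdt e1 e2
    have hsq : c ^ 2 ≤ (1 + t) ^ 2 := pow_le_pow_left₀ hc hct 2
    refine approx_rate_le_mul ht ht1 hw hL hLt hm hρ hX hD (e1.trans ?_) (e2.trans ?_)
    · gcongr
    · have : 1 + 2 * d - d ^ 2 ≤ 1 - t + 2 * √t := by
        have hdd : 0 ≤ (√t - d) * (2 - √t - d) := mul_nonneg (by linarith) (by linarith)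
        linarith
      have : 0 ≤ 1 + 2 * d - d ^ 2 := by nlinarith
      gcongr
  rcases le_total t (1 / 5) with h5 | h5
  · exact way1 (by nlinarith)
  rcases le_total t (1 / 3) with h3 | h3
  · rcases le_total (2 / 3) D with hd | hd
    · exact way1 (by nlinarith)
    · have hs : 0.44 ≤ √t := Real.le_sqrt_of_sq_le (by linarith)
      exact way2 2.6 (by norm_num) (key _ 1.2 0.44 (by norm_num) (by norm_num) (by norm_num)
        (by linarith) hs (by linarith) (by norm_num)) (by linarith)
  rcases le_total t (1 / 2) with h2 | h2
  · rcases le_total 2 D with hd | hd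
    · exact way1 (by nlinarith)
    · have hs : 0.57 ≤ √t := Real.le_sqrt_of_sq_le (by linarith)
      exact way2 1.7 (by norm_num) (key _ 1.33 0.57 (by norm_num) (by norm_num) (by norm_num)
        (by linarith) hs (by linarith) (by norm_num)) (by linarith)
  · have hs : 0.7 ≤ √t := Real.le_sqrt_of_sq_le (by linarith)
    exact way2 1 zero_le_one (key _ 1.5 0.7 zero_le_one (by norm_num) (by norm_num)
      (by linarith) hs (by linarith) (by norm_num)) (by linarith)

/-! ### Polynomials in a symmetric operator and Krylov approximation -/

section Spectral
open Polynomial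

variable {E : Type*} [NormedAddCommGroup E] [InnerProductSpace ℝ E] [FiniteDimensional ℝ E]
  {B : E →ₗ[ℝ] E}

lemma LinearMap.IsSymmetric.eigenvectorBasis_repr_aeval (hB : B.IsSymmetric) (R : ℝ[X]) (x : E)
    (i : Fin (Module.finrank ℝ E)) :
    (hB.eigenvectorBasis rfl).repr (aeval B R x) i =
      R.eval (hB.eigenvalues rfl i) * (hB.eigenvectorBasis rfl).repr x i := by
  induction R using Polynomial.induction_on with
  | C a => simp [Module.algebraMap_end_apply]
  | add p q hp hq => simp [hp, hq, add_mul]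
  | monomial n a h =>
    have : aeval B (C a * X ^ (n + 1)) x = B (aeval B (C a * X ^ n) x) := by
      rw [pow_succ', ← mul_assoc, mul_comm (C a), mul_assoc, map_mul, aeval_X]; rfl
    rw [this, hB.eigenvectorBasis_apply_self_apply, h]
    simp
    ring

lemma LinearMap.IsSymmetric.norm_aeval_apply_le (hB : B.IsSymmetric) {R : ℝ[X]} {c : ℝ}
    (hc : 0 ≤ c) (h : ∀ μ, Module.End.HasEigenvalue B μ → |R.eval μ| ≤ c) (x : E) :
    ‖aeval B R x‖ ≤ c * ‖x‖ := by
  rw [← (hB.eigenvectorBasis rfl).repr.norm_map, ← (hB.eigenvectorBasis rfl).repr.norm_map x]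
  refine le_of_sq_le_sq ?_ (by positivity)
  rw [mul_pow, EuclideanSpace.norm_sq_eq, EuclideanSpace.norm_sq_eq, Finset.mul_sum]
  refine Finset.sum_le_sum fun i _ => ?_
  rw [hB.eigenvectorBasis_repr_aeval, norm_mul, mul_pow]
  have := h _ (hB.hasEigenvalue_eigenvalues rfl i)
  rw [Real.norm_eq_abs]
  gcongr
  exact this

lemma LinearMap.IsSymmetric.inner_apply_eq_sum (hB : B.IsSymmetric) (x : E) :
    inner ℝ x (B x) = ∑ i, hB.eigenvalues rfl i * (hB.eigenvectorBasis rfl).repr x i ^ 2 := by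
  rw [← (hB.eigenvectorBasis rfl).repr.inner_map_map, PiLp.inner_apply]
  refine Finset.sum_congr rfl fun i _ => ?_
  rw [hB.eigenvectorBasis_apply_self_apply]
  simp
  ring

lemma LinearMap.IsSymmetric.mul_norm_sq_le_inner (hB : B.IsSymmetric) {a : ℝ}
    (h : ∀ μ, Module.End.HasEigenvalue B μ → a ≤ μ) (x : E) :
    a * ‖x‖ ^ 2 ≤ inner ℝ x (B x) := by
  rw [hB.inner_apply_eq_sum, ← (hB.eigenvectorBasis rfl).repr.norm_map x,
    EuclideanSpace.norm_sq_eq, Finset.mul_sum]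
  refine Finset.sum_le_sum fun i _ => ?_
  have := h _ (hB.hasEigenvalue_eigenvalues rfl i)
  rw [Real.norm_eq_abs, sq_abs]
  gcongr
  exact this

lemma LinearMap.IsSymmetric.inner_le_mul_norm_sq (hB : B.IsSymmetric) {b : ℝ}
    (h : ∀ μ, Module.End.HasEigenvalue B μ → μ ≤ b) (x : E) :
    inner ℝ x (B x) ≤ b * ‖x‖ ^ 2 := by
  rw [hB.inner_apply_eq_sum, ← (hB.eigenvectorBasis rfl).repr.norm_map x,
    EuclideanSpace.norm_sq_eq, Finset.mul_sum]
  refine Finset.sum_le_sum fun i _ => ?_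
  have := h _ (hB.hasEigenvalue_eigenvalues rfl i)
  rw [Real.norm_eq_abs, sq_abs]
  gcongr
  exact this

/-- Approximation of `s = -B⁻¹ g` and `v = B⁻¹ s` from a space that contains all `p(B) g` with
`deg p ≤ k`. The error of `s` is `R(B) s` with the Chebyshev residual `R` of degree `k + 1`. The
error of `v` is `R(B) (1 - c B) v` with `c = R'(0)`: the polynomial `R * (1 - c X)` is `1` up to
second order at `0`, and it is bounded on `v` by `R` on `v - c s`, of norm `≤ (1/a + |c|) ‖s‖`
where `a = w (1 - t)²` is the lower bound of the spectrum. -/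
lemma exists_krylov_approx {S : Submodule ℝ E} {g s v : E} {k : ℕ} {t w : ℝ}
    (hB : B.IsSymmetric) (ht : 0 < t) (ht1 : t < 1) (hw : 0 < w)
    (hlow : ∀ μ, Module.End.HasEigenvalue B μ → w * (1 - t) ^ 2 ≤ μ)
    (hupp : ∀ μ, Module.End.HasEigenvalue B μ → μ ≤ w * (1 + t) ^ 2)
    (hS : ∀ p : ℝ[X], p.natDegree ≤ k → aeval B p g ∈ S) (hs : B s = -g) (hv : B v = s) :
    (∃ x ∈ S, ‖s - x‖ ≤ 2 * t ^ (k + 1) / (1 + (t ^ (k + 1)) ^ 2) * ‖s‖) ∧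
    ∃ x ∈ S, ‖v - x‖ ≤ 2 / w * (1 / (1 - t) ^ 2 + (k + 1) / (1 - t ^ 2)) * t ^ (k + 1) * ‖s‖ := by
  obtain ⟨R, hdeg, h0, hR, hR'⟩ := exists_residual_polynomial ht ht1 hw (k + 1)
  set τ := t ^ (k + 1) with hτ
  have hτ0 : 0 < τ := by positivity
  have h1t : 0 < 1 - t := by linarith
  have ht2 : 0 < 1 - t ^ 2 := by nlinarith
  have hRn : ∀ x, ‖aeval B R x‖ ≤ 2 * τ / (1 + τ ^ 2) * ‖x‖ :=
    hB.norm_aeval_apply_le (by positivity) fun μ hμ => hR μ (hlow μ hμ) (hupp μ hμ)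
  have hc0 : R.coeff 0 = 1 := by rw [coeff_zero_eq_eval_zero, h0]
  have hR1 : R = divX R * X + 1 := by
    conv_lhs => rw [← divX_mul_X_add R, hc0, C_1]
  set c := R.coeff 1 with hc
  have hcR : |c| ≤ (k + 1) / (w * (1 - t ^ 2)) := by
    rw [← coeff_zero_eq_eval_zero, coeff_derivative] at hR'
    simpa using hR'
  have hR2 : divX R = divX (divX R) * X + C c := by
    conv_lhs => rw [← divX_mul_X_add (divX R), coeff_divX]
  constructor
  · refine ⟨aeval B (divX R) g, hS _ ?_, ?_⟩
    · rw [natDegree_divX_eq_natDegree_tsub_one]; omega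
    · refine le_trans (le_of_eq ?_) (hRn s)
      congr 1
      conv_rhs => rw [hR1]
      simp [hs]
      abel
  · set P : ℝ[X] := divX (divX R) - C c * (divX (divX R) * X) - C (c ^ 2) with hP
    have hfac : R * (1 - C c * X) = P * X * X + 1 := by
      rw [hP]
      generalize divX (divX R) = R2 at hR2
      rw [hR1, hR2, C_pow]
      ring
    refine ⟨aeval B P g, hS _ ?_, ?_⟩
    -- coefficientwise: for `k = 0` the truncated subtraction in the degree of `divX (divX R)`
    -- makes the degree bound of `divX (divX R) * X` too weak by one
    · rw [natDegree_le_iff_coeff_eq_zero]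
      intro N hN
      have hz : ∀ j, k + 1 < j → R.coeff j = 0 := fun j hj =>
        coeff_eq_zero_of_natDegree_lt (by omega)
      obtain ⟨N, rfl⟩ : ∃ j, N = j + 1 := ⟨N - 1, by omega⟩
      rw [hP]
      simp only [coeff_sub, coeff_C_mul, coeff_mul_X, coeff_divX, coeff_C_succ]
      rw [hz _ (by omega), hz _ (by omega)]
      simp
    · have hv1 : ‖v‖ ≤ 1 / (w * (1 - t) ^ 2) * ‖s‖ := by
        have h1 := hB.mul_norm_sq_le_inner hlow v
        have h2 := real_inner_le_norm v (B v)
        rw [hv] at h1 h2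
        rcases (norm_nonneg v).eq_or_lt with h | h
        · rw [← h]; positivity
        · rw [one_div, ← div_eq_inv_mul, le_div_iff₀ (by positivity)]
          have : ‖v‖ * (w * (1 - t) ^ 2 * ‖v‖) ≤ ‖v‖ * ‖s‖ := by nlinarith
          have := le_of_mul_le_mul_left this h
          linarith
      have heq : v - aeval B P g = aeval B R (v - c • s) := by
        have h1 : aeval B (R * (1 - C c * X)) v = aeval B R (v - c • s) := by
          simp [hv, Module.algebraMap_end_apply]
        rw [← h1, hfac]
        simp [hv, hs]
        abel
      rw [heq]
      calc _ ≤ 2 * τ / (1 + τ ^ 2) * ‖v - c • s‖ := hRn _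
        _ ≤ 2 * τ * (1 / (w * (1 - t) ^ 2) * ‖s‖ + (k + 1) / (w * (1 - t ^ 2)) * ‖s‖) := by
          gcongr
          · exact div_le_self (by positivity) (by nlinarith)
          · refine (norm_sub_le _ _).trans (add_le_add hv1 ?_)
            rw [norm_smul, Real.norm_eq_abs]
            gcongr
        _ = _ := by field_simp

end Spectral

lemma aeval_toEuclideanLin_mem_krylov {n : ℕ} (A : Matrix (Fin n) (Fin n) ℝ)
    (g : EuclideanSpace ℝ (Fin n)) (k : ℕ) (lam : ℝ) (p : Polynomial ℝ) (hp : p.natDegree ≤ k) :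
    Polynomial.aeval (Matrix.toEuclideanLin (A + lam • (1 : Matrix (Fin n) (Fin n) ℝ))) p g ∈
      krylov A g k := by
  have h1 : Matrix.toEuclideanLin (A + lam • (1 : Matrix (Fin n) (Fin n) ℝ)) =
      Polynomial.aeval (Matrix.toEuclideanLin A) (Polynomial.X + Polynomial.C lam) := by
    rw [map_add, map_smul, Matrix.toLpLin_one]
    ext x
    simp [Module.algebraMap_end_apply]
  rw [h1, ← Polynomial.aeval_comp]
  have hdeg : (p.comp (Polynomial.X + Polynomial.C lam)).natDegree < k + 1 := by
    refine Nat.lt_succ_of_le (Polynomial.natDegree_comp_le.trans ?_)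
    rw [Polynomial.natDegree_X_add_C]; omega
  rw [Polynomial.aeval_eq_sum_range' hdeg, LinearMap.sum_apply]
  refine Submodule.sum_mem _ fun i hi => ?_
  rw [LinearMap.smul_apply, ← Matrix.toLpLin_pow]
  exact Submodule.smul_mem _ _ (Submodule.subset_span ⟨⟨i, Finset.mem_range.1 hi⟩, rfl⟩)

/-! ### Optimality conditions and the augmented eigenvalue equation -/

section Optimality
variable {E : Type*} [NormedAddCommGroup E] [InnerProductSpace ℝ E]

/-- Let `θ` tend to `0`. -/
lemma nonneg_of_forall_quadratic_nonneg {a b c : ℝ}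
    (h : ∀ θ : ℝ, 0 < θ → θ ≤ 1 → 0 ≤ a + b * θ + c * θ ^ 2) : 0 ≤ a := by
  have hlim : Filter.Tendsto (fun θ : ℝ => a + b * θ + c * θ ^ 2) (nhdsWithin 0 (Set.Ioi 0))
      (nhds a) := by
    have : Continuous fun θ : ℝ => a + b * θ + c * θ ^ 2 := by fun_prop
    simpa using (this.tendsto 0).mono_left nhdsWithin_le_nhds
  refine ge_of_tendsto hlim ?_
  filter_upwards [Ioc_mem_nhdsGT (zero_lt_one (α := ℝ))] with θ hθ using h θ hθ.1 hθ.2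

/-- Necessary optimality conditions for a minimizer on the boundary of the ball. The gradient `r`
is a nonpositive multiple of `s` because `⟪r, ·⟫` attains its minimum over the ball at `s`. -/
lemma exists_multiplier_of_isMin {L : E →ₗ[ℝ] E} (hL : L.IsSymmetric) {g s : E} {Δ : ℝ}
    (hΔ : 0 < Δ) (hs : ‖s‖ = Δ)
    (hmin : ∀ x, ‖x‖ ≤ Δ →
      inner ℝ g s + (1 / 2) * inner ℝ s (L s) ≤ inner ℝ g x + (1 / 2) * inner ℝ x (L x)) :
    ∃ lam : ℝ, 0 ≤ lam ∧ L s + lam • s = -g ∧ ∀ x, 0 ≤ inner ℝ x (L x + lam • x) := by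
  set r := L s + g with hr
  have hexp : ∀ d : E, ‖s + d‖ ≤ Δ → 0 ≤ inner ℝ r d + (1 / 2) * inner ℝ d (L d) := by
    intro d hd
    have h := hmin _ hd
    have h1 : inner ℝ s (L d) = inner ℝ (L s) d := (hL s d).symm
    have h2 : inner ℝ d (L s) = inner ℝ (L s) d := real_inner_comm _ _
    simp only [map_add, inner_add_left, inner_add_right, hr] at h ⊢
    linarith
  have hfirst : ∀ x, ‖x‖ ≤ Δ → 0 ≤ inner ℝ r (x - s) := by
    intro x hx
    refine nonneg_of_forall_quadratic_nonneg (b := (1 / 2) * inner ℝ (x - s) (L (x - s))) (c := 0)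
      fun θ hθ hθ1 => ?_
    have hb : ‖s + θ • (x - s)‖ ≤ Δ := by
      have : s + θ • (x - s) = (1 - θ) • s + θ • x := by module
      rw [this]
      refine (norm_add_le _ _).trans ?_
      rw [norm_smul, norm_smul, Real.norm_of_nonneg hθ.le, Real.norm_of_nonneg (by linarith), hs]
      nlinarith
    have h := hexp _ hb
    simp only [map_smul, inner_smul_left, inner_smul_right] at h
    have h' : 0 ≤ θ * (inner ℝ r (x - s) + (1 / 2) * inner ℝ (x - s) (L (x - s)) * θ) := by
      refine h.trans_eq ?_
      simp
      ring
    have := nonneg_of_mul_nonneg_right h' hθ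
    linarith
  have hrs : inner ℝ r s ≤ -(‖r‖ * Δ) := by
    rcases eq_or_ne r 0 with h0 | h0
    · simp [h0]
    · have hn : 0 < ‖r‖ := norm_pos_iff.2 h0
      have h := hfirst (-((Δ / ‖r‖) • r)) (by
        rw [norm_neg, norm_smul, Real.norm_of_nonneg (by positivity)]
        exact le_of_eq (by field_simp))
      rw [inner_sub_right, inner_neg_right, inner_smul_right, real_inner_self_eq_norm_sq] at h
      have : Δ / ‖r‖ * ‖r‖ ^ 2 = ‖r‖ * Δ := by field_simp
      linarith
  have hrs0 : Δ • r + ‖r‖ • s = 0 := by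
    have h : ‖Δ • r + ‖r‖ • s‖ ^ 2 ≤ 0 := by
      rw [norm_add_sq_real, norm_smul, norm_smul, inner_smul_left, inner_smul_right, hs]
      simp only [Real.norm_eq_abs, abs_of_pos hΔ, abs_norm, conj_trivial]
      nlinarith [mul_nonneg hΔ.le (norm_nonneg r)]
    exact norm_eq_zero.1 (pow_eq_zero_iff two_ne_zero |>.1 (le_antisymm h (by positivity)))
  have hr' : r = -((‖r‖ / Δ) • s) := by
    have h1 : Δ⁻¹ • (Δ • r + ‖r‖ • s) = r + (‖r‖ / Δ) • s := by
      rw [smul_add, smul_smul, smul_smul, inv_mul_cancel₀ hΔ.ne', one_smul, div_eq_inv_mul]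
    rw [hrs0, smul_zero] at h1
    exact eq_neg_of_add_eq_zero_left h1.symm
  set lam := ‖r‖ / Δ with hlam
  have hlam0 : 0 ≤ lam := by positivity
  clear_value lam
  -- compare `s` with its reflection along `p`, which lies on the sphere again
  have hcurv : ∀ p, inner ℝ s p ≠ 0 → 0 ≤ inner ℝ p (L p + lam • p) := by
    intro p hp
    have hp0 : 0 < ‖p‖ := norm_pos_iff.2 (by rintro rfl; simp at hp)
    set η := -2 * inner ℝ s p / ‖p‖ ^ 2 with hη
    have hη0 : η ≠ 0 := div_ne_zero (mul_ne_zero (by norm_num) hp) (by positivity)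
    have hη2 : η * ‖p‖ ^ 2 = -2 * inner ℝ s p := by rw [hη]; field_simp
    have hn : ‖s + η • p‖ ≤ Δ := by
      refine le_of_sq_le_sq ?_ hΔ.le
      rw [norm_add_sq_real, norm_smul, mul_pow, Real.norm_eq_abs, sq_abs, inner_smul_right, hs]
      have : η * (η * ‖p‖ ^ 2) = η * (-2 * inner ℝ s p) := by rw [hη2]
      linarith
    have h := hexp _ hn
    rw [hr', inner_neg_left, inner_smul_left, map_smul, inner_smul_left, inner_smul_right,
      inner_smul_right] at h
    simp only [conj_trivial] at h
    rw [inner_add_right, inner_smul_right, real_inner_self_eq_norm_sq]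
    have h' : 0 ≤ η ^ 2 * (inner ℝ p (L p) + lam * ‖p‖ ^ 2) := by
      have : lam * η * (η * ‖p‖ ^ 2) = lam * η * (-2 * inner ℝ s p) := by rw [hη2]
      nlinarith
    exact nonneg_of_mul_nonneg_right h' (by positivity)
  refine ⟨lam, hlam0, ?_, fun p => ?_⟩
  · have : L s = -(lam • s) - g := by rw [← hr', hr]; abel
    rw [this]; abel
  -- a direction tangent to the sphere is a limit of directions `p + θ • s`
  · by_cases hp : inner ℝ s p = 0
    · refine nonneg_of_forall_quadratic_nonneg
        (b := inner ℝ p (L s + lam • s) + inner ℝ s (L p + lam • p))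
        (c := inner ℝ s (L s + lam • s)) fun θ hθ _ => ?_
      have h := hcurv (p + θ • s) (by
        rw [inner_add_right, hp, zero_add, inner_smul_right, real_inner_self_eq_norm_sq, hs]
        positivity)
      refine h.trans_eq ?_
      simp only [map_add, map_smul, inner_add_left, inner_add_right, inner_smul_left,
        inner_smul_right, smul_add, conj_trivial]
      ring
    · exact hcurv p hp

/-- The equations say that `(y₁, y₂)` is an eigenvector of the augmented matrix for the eigenvalue
`lam + δ`, where `B = A + lam I`. They force `‖y₁‖ = |c| Δ` with `(B + δ) y₁ = c g`; if `B` is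
positive definite and `δ ≥ 0`, then `e = y₁ + c s` satisfies `⟪e, B e⟫ = -δ ⟪e, y₁⟫ ≤ 0`, so that
`e = 0`. -/
lemma eq_smul_of_augmented_eigenvector {B : E →ₗ[ℝ] E} (hB : B.IsSymmetric)
    (hpos : ∀ x, x ≠ 0 → 0 < inner ℝ x (B x)) {g s y₁ y₂ : E} {Δ δ : ℝ} (hΔ : 0 < Δ)
    (hδ : 0 ≤ δ) (hs : B s = -g) (hsΔ : ‖s‖ = Δ)
    (h₁ : B y₁ + δ • y₁ = ((Δ ^ 2)⁻¹ * inner ℝ g y₂) • g) (h₂ : B y₂ + δ • y₂ = y₁)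
    (hy : y₁ ≠ 0 ∨ y₂ ≠ 0) : δ = 0 ∧ ∃ c : ℝ, c ≠ 0 ∧ y₁ = c • s := by
  have hinj : ∀ x, B x + δ • x = 0 → x = 0 := by
    intro x hx
    by_contra hne
    have h := congrArg (inner ℝ x) hx
    rw [inner_add_right, inner_smul_right, inner_zero_right, real_inner_self_eq_norm_sq] at h
    nlinarith [hpos x hne, mul_nonneg hδ (sq_nonneg ‖x‖)]
  set c := (Δ ^ 2)⁻¹ * inner ℝ g y₂ with hc
  have hc0 : c ≠ 0 := by
    intro h0
    rw [h0, zero_smul] at h₁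
    have hy1 := hinj _ h₁
    rw [hy1] at h₂
    have hy2 := hinj _ h₂
    tauto
  have hgy : inner ℝ g y₂ = c * Δ ^ 2 := by rw [hc]; field_simp
  have hn : ‖y₁‖ ^ 2 = (c * Δ) ^ 2 := by
    have h : inner ℝ (B y₁ + δ • y₁) y₂ = inner ℝ y₁ (B y₂ + δ • y₂) := by
      rw [inner_add_left, inner_add_right, inner_smul_left, inner_smul_right, hB]; simp
    rw [h₁, h₂, inner_smul_left, hgy, real_inner_self_eq_norm_sq] at h
    rw [← h]; simp; ring
  have hBe : B (y₁ + c • s) = -(δ • y₁) := by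
    rw [map_add, map_smul, hs, smul_neg, ← h₁]; abel
  have he : y₁ + c • s = 0 := by
    by_contra hne
    have h := hpos _ hne
    rw [hBe, inner_neg_right, inner_smul_right, inner_add_left, inner_smul_left,
      real_inner_self_eq_norm_sq] at h
    simp only [conj_trivial] at h
    have h3 : |c * inner ℝ s y₁| ≤ ‖y₁‖ ^ 2 := by
      have h4 : ‖y₁‖ = |c| * Δ := by
        rw [← abs_of_pos hΔ, ← abs_mul, ← abs_norm, (sq_eq_sq_iff_abs_eq_abs _ _).1 hn]
      rw [abs_mul]
      calc |c| * |inner ℝ s y₁| ≤ |c| * (‖s‖ * ‖y₁‖) := by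
            gcongr; exact abs_real_inner_le_norm _ _
        _ = ‖y₁‖ ^ 2 := by rw [hsΔ, pow_two]; nth_rewrite 2 [h4]; ring
    have := (abs_le.1 h3).1
    nlinarith [mul_nonneg hδ (show 0 ≤ ‖y₁‖ ^ 2 + c * inner ℝ s y₁ by linarith)]
  have hy1 : y₁ = (-c) • s := by rw [neg_smul]; exact eq_neg_of_add_eq_zero_left he
  refine ⟨?_, -c, neg_ne_zero.2 hc0, hy1⟩
  rw [he, map_zero, eq_comm, neg_eq_zero, smul_eq_zero] at hBe
  refine hBe.resolve_right ?_
  rw [hy1]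
  exact smul_ne_zero (neg_ne_zero.2 hc0) (norm_pos_iff.1 (by rw [hsΔ]; exact hΔ))

end Optimality

/-! ### Matrices acting on Euclidean spaces -/

lemma toEuclideanLin_mul_apply {ι κ μ : Type*} [Fintype κ] [DecidableEq κ] [Fintype μ]
    [DecidableEq μ] (V : Matrix ι κ ℝ)
    (W : Matrix κ μ ℝ) (u : EuclideanSpace ℝ μ) :
    Matrix.toEuclideanLin (V * W) u = Matrix.toEuclideanLin V (Matrix.toEuclideanLin W u) := by
  rw [Matrix.toLpLin_mul (q := 2)]; rfl

lemma isSymm_add_smul_one {ι : Type*} [DecidableEq ι] {A : Matrix ι ι ℝ} (hA : A.IsSymm) (c : ℝ) :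
    (A + c • (1 : Matrix ι ι ℝ)).IsSymm := by
  rw [Matrix.IsSymm, Matrix.transpose_add, Matrix.transpose_smul, Matrix.transpose_one, hA.eq]

lemma colMatrix_transpose_mul_self {ι κ : Type*} [Fintype ι] [DecidableEq κ]
    {v : κ → EuclideanSpace ℝ ι} (hv : Orthonormal ℝ v) :
    (colMatrix v)ᵀ * colMatrix v = 1 := by
  ext i j
  rw [Matrix.mul_apply, Matrix.one_apply, ← orthonormal_iff_ite.1 hv i j, PiLp.inner_apply]
  simp [colMatrix, mul_comm]

lemma toEuclideanLin_colMatrix_apply {ι κ : Type*} [Fintype κ] [DecidableEq κ]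
    (v : κ → EuclideanSpace ℝ ι) (u : EuclideanSpace ℝ κ) :
    Matrix.toEuclideanLin (colMatrix v) u = ∑ j, u j • v j := by
  ext i
  simp [Matrix.toLpLin_apply, Matrix.mulVec, dotProduct, colMatrix, mul_comm]

section Matrices
variable {ι κ : Type*} [Fintype ι] [Fintype κ] [DecidableEq ι] [DecidableEq κ]

lemma inner_toEuclideanLin_left (W : Matrix ι κ ℝ) (u : EuclideanSpace ℝ κ)
    (x : EuclideanSpace ℝ ι) :
    inner ℝ (Matrix.toEuclideanLin W u) x = inner ℝ u (Matrix.toEuclideanLin Wᵀ x) := by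
  rw [← Matrix.conjTranspose_eq_transpose_of_trivial, Matrix.toEuclideanLin_conjTranspose_eq_adjoint,
    LinearMap.adjoint_inner_right]

lemma toEuclideanLin_add_smul_one_apply (A : Matrix ι ι ℝ) (c : ℝ) (x : EuclideanSpace ℝ ι) :
    Matrix.toEuclideanLin (A + c • (1 : Matrix ι ι ℝ)) x = Matrix.toEuclideanLin A x + c • x := by
  rw [map_add, map_smul, Matrix.toLpLin_one]; rfl

lemma toEuclideanLin_sub_smul_one_apply (A : Matrix ι ι ℝ) (c : ℝ) (x : EuclideanSpace ℝ ι) :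
    Matrix.toEuclideanLin (A - c • (1 : Matrix ι ι ℝ)) x = Matrix.toEuclideanLin A x - c • x := by
  rw [map_sub, map_smul, Matrix.toLpLin_one]; rfl

lemma norm_toEuclideanLin_apply_le (B : Matrix ι ι ℝ) (x : EuclideanSpace ℝ ι) :
    ‖Matrix.toEuclideanLin B x‖ ≤ specNorm B * ‖x‖ :=
  (Matrix.toEuclideanCLM (n := ι) (𝕜 := ℝ) B).le_opNorm x

lemma isSymmetric_toEuclideanLin {A : Matrix ι ι ℝ} (hA : A.IsSymm) :
    (Matrix.toEuclideanLin A).IsSymmetric :=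
  Matrix.isSymmetric_toEuclideanLin_iff.2 (by
    rw [Matrix.IsHermitian, Matrix.conjTranspose_eq_transpose_of_trivial, hA.eq])

lemma norm_toEuclideanLin_of_transpose_mul_self {W : Matrix ι κ ℝ} (hW : Wᵀ * W = 1)
    (u : EuclideanSpace ℝ κ) : ‖Matrix.toEuclideanLin W u‖ = ‖u‖ := by
  have h : ‖Matrix.toEuclideanLin W u‖ ^ 2 = ‖u‖ ^ 2 := by
    rw [← real_inner_self_eq_norm_sq, inner_toEuclideanLin_left, ← toEuclideanLin_mul_apply, hW,
      Matrix.toLpLin_one, LinearMap.id_apply, real_inner_self_eq_norm_sq]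
  exact (sq_eq_sq₀ (norm_nonneg _) (norm_nonneg _)).1 h

lemma norm_toEuclideanLin_transpose_le {W : Matrix ι κ ℝ} (hW : Wᵀ * W = 1)
    (x : EuclideanSpace ℝ ι) : ‖Matrix.toEuclideanLin Wᵀ x‖ ≤ ‖x‖ := by
  set u := Matrix.toEuclideanLin Wᵀ x with hu
  have h1 : ‖u‖ ^ 2 ≤ ‖u‖ * ‖x‖ := by
    rw [← real_inner_self_eq_norm_sq]
    nth_rewrite 2 [hu]
    rw [← inner_toEuclideanLin_left, ← norm_toEuclideanLin_of_transpose_mul_self hW u]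
    exact real_inner_le_norm _ _
  rcases (norm_nonneg u).eq_or_lt with h | h
  · rw [← h]; exact norm_nonneg x
  · rw [pow_two] at h1; exact le_of_mul_le_mul_left h1 h

/-- `W Wᵀ x` is the best approximation of `x` from the range of `W`. -/
lemma norm_sub_projection_le {W : Matrix ι κ ℝ} (hW : Wᵀ * W = 1) (x : EuclideanSpace ℝ ι)
    (u : EuclideanSpace ℝ κ) :
    ‖x - Matrix.toEuclideanLin W (Matrix.toEuclideanLin Wᵀ x)‖ ≤ ‖x - Matrix.toEuclideanLin W u‖ := by
  set p := Matrix.toEuclideanLin Wᵀ x with hp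
  have horth : inner ℝ (x - Matrix.toEuclideanLin W p) (Matrix.toEuclideanLin W (p - u)) = 0 := by
    rw [real_inner_comm, inner_toEuclideanLin_left, map_sub, ← toEuclideanLin_mul_apply, hW,
      Matrix.toLpLin_one, LinearMap.id_apply, ← hp, sub_self, inner_zero_right]
  have hdec : x - Matrix.toEuclideanLin W u =
      (x - Matrix.toEuclideanLin W p) + Matrix.toEuclideanLin W (p - u) := by
    rw [map_sub]; abel
  refine le_of_sq_le_sq ?_ (norm_nonneg _)
  rw [hdec, norm_add_sq_real, horth]
  nlinarith [sq_nonneg ‖Matrix.toEuclideanLin W (p - u)‖]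

lemma ofReal_mem_spectrum_of_eigenvector {B : Matrix ι ι ℝ} {ν : ℝ} {x : EuclideanSpace ℝ ι}
    (hx : x ≠ 0) (h : Matrix.toEuclideanLin B x = ν • x) :
    (ν : ℂ) ∈ spectrum ℂ (B.map Complex.ofReal) := by
  rw [spectrum.mem_iff]
  intro hu
  rw [Matrix.isUnit_iff_isUnit_det, isUnit_iff_ne_zero] at hu
  apply hu
  have h1 : algebraMap ℂ (Matrix ι ι ℂ) ν - B.map Complex.ofReal =
      (ν • (1 : Matrix ι ι ℝ) - B).map Complex.ofRealHom := by
    ext i j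
    simp [Matrix.algebraMap_matrix_apply, Matrix.one_apply]
    split_ifs <;> simp
  have h2 : (ν • (1 : Matrix ι ι ℝ) - B).det = 0 := by
    rw [← Matrix.exists_mulVec_eq_zero_iff]
    refine ⟨x.ofLp, fun h0 => hx (by ext i; exact congrFun h0 i), ?_⟩
    have h3 : B *ᵥ x.ofLp = ν • x.ofLp := congrArg WithLp.ofLp h
    rw [Matrix.sub_mulVec, Matrix.smul_mulVec, Matrix.one_mulVec, h3, sub_self]
  rw [h1, ← RingHom.mapMatrix_apply, ← RingHom.map_det, h2, map_zero]

lemma hasEigenvalue_toEuclideanLin_iff_mem_spectrum {A : Matrix ι ι ℝ} {ν : ℝ} :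
    Module.End.HasEigenvalue (Matrix.toEuclideanLin A) ν ↔ ν ∈ spectrum ℝ A := by
  rw [Module.End.hasEigenvalue_iff_mem_spectrum, Matrix.spectrum_toLpLin]

end Matrices

/-! ### Block vectors -/

section Blocks
variable {ι : Type*}

/-- The first block of a vector of `ℝ^ι ⊕ ℝ^ι`. -/
def upperPart (y : EuclideanSpace ℝ (ι ⊕ ι)) : EuclideanSpace ℝ ι :=
  WithLp.toLp 2 fun i => y (Sum.inl i)

/-- The second block of a vector of `ℝ^ι ⊕ ℝ^ι`. -/
def lowerPart (y : EuclideanSpace ℝ (ι ⊕ ι)) : EuclideanSpace ℝ ι :=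
  WithLp.toLp 2 fun i => y (Sum.inr i)

/-- The vector with the given blocks. -/
def joinParts (u v : EuclideanSpace ℝ ι) : EuclideanSpace ℝ (ι ⊕ ι) :=
  WithLp.toLp 2 (Sum.elim u v)

@[simp] lemma upperPart_joinParts (u v : EuclideanSpace ℝ ι) : upperPart (joinParts u v) = u := rfl
@[simp] lemma lowerPart_joinParts (u v : EuclideanSpace ℝ ι) : lowerPart (joinParts u v) = v := rfl

lemma ext_parts {x y : EuclideanSpace ℝ (ι ⊕ ι)} (h₁ : upperPart x = upperPart y)
    (h₂ : lowerPart x = lowerPart y) : x = y := by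
  ext i
  rcases i with i | i
  · exact congrArg (fun u : EuclideanSpace ℝ ι => u i) h₁
  · exact congrArg (fun u : EuclideanSpace ℝ ι => u i) h₂

variable [Fintype ι]

lemma inner_eq_inner_parts (x y : EuclideanSpace ℝ (ι ⊕ ι)) :
    inner ℝ x y = inner ℝ (upperPart x) (upperPart y) + inner ℝ (lowerPart x) (lowerPart y) := by
  simp [PiLp.inner_apply, upperPart, lowerPart, Fintype.sum_sum_type]

lemma norm_sq_eq_norm_sq_parts (x : EuclideanSpace ℝ (ι ⊕ ι)) :
    ‖x‖ ^ 2 = ‖upperPart x‖ ^ 2 + ‖lowerPart x‖ ^ 2 := by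
  simp only [← real_inner_self_eq_norm_sq, inner_eq_inner_parts]

end Blocks

lemma toEuclideanLin_blockDiag_apply {ι κ : Type*} [Fintype κ] [DecidableEq κ]
    (W : Matrix ι κ ℝ) (u : EuclideanSpace ℝ (κ ⊕ κ)) :
    Matrix.toEuclideanLin (Matrix.fromBlocks W 0 0 W) u =
      joinParts (Matrix.toEuclideanLin W (upperPart u)) (Matrix.toEuclideanLin W (lowerPart u)) := by
  ext i
  rcases i with i | i <;>
  simp [Matrix.toLpLin_apply, Matrix.mulVec, dotProduct, joinParts, upperPart, lowerPart,
    Fintype.sum_sum_type]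

/-! ### The rightmost eigenvector of the augmented matrix -/


section Augmented
variable {n : ℕ} {A : Matrix (Fin n) (Fin n) ℝ} {g : EuclideanSpace ℝ (Fin n)} {Δ : ℝ}

lemma toEuclideanLin_augMatrix_apply (y : EuclideanSpace ℝ (Fin n ⊕ Fin n)) :
    Matrix.toEuclideanLin (augMatrix A g Δ) y =
      joinParts (-Matrix.toEuclideanLin A (upperPart y) +
          ((Δ ^ 2)⁻¹ * inner ℝ g (lowerPart y)) • g)
        (upperPart y - Matrix.toEuclideanLin A (lowerPart y)) := by
  ext i
  rcases i with i | i
  · simp [Matrix.toLpLin_apply, Matrix.mulVec, dotProduct, joinParts, upperPart, lowerPart, augMatrix,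
      Fintype.sum_sum_type, Matrix.vecMulVec_apply, PiLp.inner_apply, Finset.mul_sum, Finset.sum_mul]
    exact Finset.sum_congr rfl fun _ _ => by ring
  · simp [Matrix.toLpLin_apply, Matrix.mulVec, dotProduct, joinParts, upperPart, lowerPart, augMatrix,
      Fintype.sum_sum_type, Matrix.one_apply, sub_eq_add_neg]

lemma augMatrix_apply_eq_smul_iff {μ : ℝ} {y : EuclideanSpace ℝ (Fin n ⊕ Fin n)} :
    Matrix.toEuclideanLin (augMatrix A g Δ) y = μ • y ↔
      Matrix.toEuclideanLin A (upperPart y) + μ • upperPart y =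
          ((Δ ^ 2)⁻¹ * inner ℝ g (lowerPart y)) • g ∧
        Matrix.toEuclideanLin A (lowerPart y) + μ • lowerPart y = upperPart y := by
  rw [toEuclideanLin_augMatrix_apply]
  constructor
  · intro h
    have h1 := congrArg upperPart h
    have h2 := congrArg lowerPart h
    change _ = μ • upperPart y at h1
    change _ = μ • lowerPart y at h2
    rw [upperPart_joinParts] at h1
    rw [lowerPart_joinParts] at h2
    rw [← h1, ← h2]
    constructor <;> abel
  · rintro ⟨h1, h2⟩
    apply ext_parts
    · change _ = μ • upperPart y
      rw [upperPart_joinParts, ← h1]; abel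
    · change _ = μ • lowerPart y
      rw [lowerPart_joinParts, sub_eq_iff_eq_add, ← h2]; abel

/-- If `A + lam I` is positive definite and `s` is the solution with multiplier `lam` on the
boundary, then `lam` is an eigenvalue of the augmented matrix, so the rightmost eigenvalue is
`≥ lam`. Its eigenvectors are then the nonzero multiples of `(s, (A + lam I)⁻¹ s)`. -/
lemma augMatrix_rightmost_eigenvector (hA : A.IsSymm) (hΔ : 0 < Δ) {lam : ℝ}
    {s : EuclideanSpace ℝ (Fin n)} (hpos : ∀ x : EuclideanSpace ℝ (Fin n), x ≠ 0 →
      0 < inner ℝ x (Matrix.toEuclideanLin (A + lam • (1 : Matrix (Fin n) (Fin n) ℝ)) x))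
    (hs : Matrix.toEuclideanLin (A + lam • (1 : Matrix (Fin n) (Fin n) ℝ)) s = -g) (hsΔ : ‖s‖ = Δ)
    {μ : ℝ} (hμ : IsRightmostEigenvalue (augMatrix A g Δ) μ)
    {y : EuclideanSpace ℝ (Fin n ⊕ Fin n)} (hy : IsUnitEigenvector (augMatrix A g Δ) μ y) :
    ∃ c : ℝ, c ≠ 0 ∧ upperPart y = c • s ∧
      Matrix.toEuclideanLin (A + lam • (1 : Matrix (Fin n) (Fin n) ℝ)) (lowerPart y) =
        upperPart y := by
  set B := Matrix.toEuclideanLin (A + lam • (1 : Matrix (Fin n) (Fin n) ℝ)) with hBdef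
  have hB : B.IsSymmetric := isSymmetric_toEuclideanLin (isSymm_add_smul_one hA lam)
  have hBx : ∀ x, B x = Matrix.toEuclideanLin A x + lam • x :=
    toEuclideanLin_add_smul_one_apply A lam
  have hs0 : s ≠ 0 := norm_pos_iff.1 (by rw [hsΔ]; exact hΔ)
  have hinj : Function.Injective B := by
    rw [← LinearMap.ker_eq_bot, LinearMap.ker_eq_bot']
    intro x hx
    by_contra hne
    have := hpos x hne
    simp [hx] at this
  have hle : lam ≤ μ := by
    obtain ⟨v, hv⟩ := LinearMap.injective_iff_surjective.1 hinj s
    have hgv : inner ℝ g v = -Δ ^ 2 := by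
      have : g = -B s := by rw [hs, neg_neg]
      rw [this, inner_neg_left, hB, hv, real_inner_self_eq_norm_sq, hsΔ]
    have h := hμ.2 lam (ofReal_mem_spectrum_of_eigenvector (x := joinParts s v)
      (fun h0 => hs0 (by simpa using congrArg upperPart h0 : s = upperPart 0))
      (augMatrix_apply_eq_smul_iff.2 ⟨?_, ?_⟩))
    · simpa using h
    · rw [upperPart_joinParts, lowerPart_joinParts, ← hBx, hs, hgv]
      have : (Δ ^ 2)⁻¹ * -Δ ^ 2 = -1 := by field_simp
      rw [this, neg_one_smul]
    · rw [upperPart_joinParts, lowerPart_joinParts, ← hBx, hv]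
  obtain ⟨h1, h2⟩ := augMatrix_apply_eq_smul_iff.1 hy.1
  have hsplit : ∀ x, B x + (μ - lam) • x = Matrix.toEuclideanLin A x + μ • x := fun x => by
    rw [hBx, sub_smul]; abel
  have hy0 : upperPart y ≠ 0 ∨ lowerPart y ≠ 0 := by
    by_contra! h
    have := norm_sq_eq_norm_sq_parts y
    rw [hy.2, h.1, h.2] at this
    norm_num at this
  rw [← hsplit] at h1 h2
  obtain ⟨hδ, c, hc, hyc⟩ :=
    eq_smul_of_augmented_eigenvector hB hpos hΔ (sub_nonneg.2 hle) hs hsΔ h1 h2 hy0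
  refine ⟨c, hc, hyc, ?_⟩
  rw [hδ, zero_smul, add_zero] at h2
  exact h2

end Augmented

/-! ### Perturbation of the eigenvector -/

section Perturbation
variable {ι κ τ : Type*} [Fintype ι] [Fintype κ] [Fintype τ] [DecidableEq ι] [DecidableEq κ]
  [DecidableEq τ]

lemma isUnit_det_of_sep_pos {μ : ℝ} {C : Matrix τ τ ℝ} (h : 0 < sep μ C) :
    IsUnit (C - μ • (1 : Matrix τ τ ℝ)).det := by
  by_contra hn
  rw [sep, Matrix.nonsing_inv_apply_not_isUnit _ hn, specNorm, map_zero, norm_zero, inv_zero] at h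
  exact lt_irrefl _ h

lemma sep_mul_norm_le {μ : ℝ} {C : Matrix τ τ ℝ} (h : 0 < sep μ C) (x : EuclideanSpace ℝ τ) :
    sep μ C * ‖x‖ ≤ ‖Matrix.toEuclideanLin C x - μ • x‖ := by
  have h1 := norm_toEuclideanLin_apply_le (C - μ • (1 : Matrix τ τ ℝ))⁻¹
    (Matrix.toEuclideanLin (C - μ • (1 : Matrix τ τ ℝ)) x)
  rw [← toEuclideanLin_mul_apply, Matrix.nonsing_inv_mul _ (isUnit_det_of_sep_pos h),
    Matrix.toLpLin_one, LinearMap.id_apply, toEuclideanLin_sub_smul_one_apply] at h1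
  rw [sep] at h ⊢
  rw [inv_mul_le_iff₀ (inv_pos.1 h)]
  exact h1

lemma sep_compression_le {M : Matrix ι ι ℝ} {W : Matrix ι κ ℝ} {V : Matrix κ τ ℝ} [Nonempty τ]
    (hW : Wᵀ * W = 1) (hV : Vᵀ * V = 1) {μ : ℝ} {y : EuclideanSpace ℝ ι}
    (hy : IsUnitEigenvector M μ y) (hsep : 0 < sep μ (Vᵀ * (Wᵀ * M * W) * V)) :
    sep μ (Vᵀ * (Wᵀ * M * W) * V) ≤ 2 * specNorm M := by
  obtain ⟨j⟩ := ‹Nonempty τ›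
  set x : EuclideanSpace ℝ τ := EuclideanSpace.single j 1 with hx
  have hx1 : ‖x‖ = 1 := by simp [hx]
  have h := sep_mul_norm_le hsep x
  rw [hx1, mul_one] at h
  have hμ : |μ| ≤ specNorm M := by
    have := norm_toEuclideanLin_apply_le M y
    rwa [hy.1, norm_smul, hy.2, mul_one, mul_one] at this
  refine h.trans ((norm_sub_le _ _).trans ?_)
  rw [norm_smul, hx1, mul_one, two_mul]
  refine add_le_add ?_ hμ
  simp only [toEuclideanLin_mul_apply]
  refine (norm_toEuclideanLin_transpose_le hV _).trans
    ((norm_toEuclideanLin_transpose_le hW _).trans ((norm_toEuclideanLin_apply_le M _).trans ?_))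
  rw [norm_toEuclideanLin_of_transpose_mul_self hW, norm_toEuclideanLin_of_transpose_mul_self hV,
    hx1, mul_one]

/-- The distance of an eigenvector `y` of `M` from the line of a Ritz vector `W z`, in terms of the
distance of `y` from the range of `W`. With `u = Wᵀ y`, the residual `(M_k - μ) u` equals
`Wᵀ M (W u - y)`, and its component orthogonal to `z` is `(C - μ) Vᵀ u`. -/
lemma exists_norm_sub_smul_ritzVector_le {M : Matrix ι ι ℝ} {W : Matrix ι κ ℝ} {V : Matrix κ τ ℝ}
    (hW : Wᵀ * W = 1) (hV : Vᵀ * V = 1) {μ μ' : ℝ} {y : EuclideanSpace ℝ ι}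
    {z : EuclideanSpace ℝ κ} (hy : Matrix.toEuclideanLin M y = μ • y)
    (hz : Matrix.toEuclideanLin (Wᵀ * M * W) z = μ' • z)
    (hVz : Matrix.toEuclideanLin Vᵀ z = 0)
    (hdec : ∀ u, ∃ c : ℝ, u = c • z + Matrix.toEuclideanLin V (Matrix.toEuclideanLin Vᵀ u))
    (hsep : 0 < sep μ (Vᵀ * (Wᵀ * M * W) * V)) :
    ∃ c : ℝ, ‖y - c • Matrix.toEuclideanLin W z‖ ≤
      (1 + specNorm M / sep μ (Vᵀ * (Wᵀ * M * W) * V)) *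
        ‖y - Matrix.toEuclideanLin W (Matrix.toEuclideanLin Wᵀ y)‖ := by
  set u := Matrix.toEuclideanLin Wᵀ y with hu
  set ε := ‖y - Matrix.toEuclideanLin W u‖ with hε
  set x := Matrix.toEuclideanLin Vᵀ u with hx
  obtain ⟨c, hc⟩ := hdec u
  rw [← hx] at hc
  have hres : Matrix.toEuclideanLin (Wᵀ * M * W) u - μ • u =
      Matrix.toEuclideanLin Wᵀ (Matrix.toEuclideanLin M (Matrix.toEuclideanLin W u - y)) := by
    rw [map_sub, map_sub, hy, map_smul, ← hu]
    simp only [toEuclideanLin_mul_apply]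
  have hCx : Matrix.toEuclideanLin (Vᵀ * (Wᵀ * M * W) * V) x - μ • x =
      Matrix.toEuclideanLin Vᵀ (Matrix.toEuclideanLin (Wᵀ * M * W) u - μ • u) := by
    rw [map_sub, map_smul, ← hx, toEuclideanLin_mul_apply, toEuclideanLin_mul_apply Vᵀ]
    conv_rhs => rw [hc]
    rw [map_add, map_add, map_smul, hz, map_smul, map_smul, hVz, smul_zero, smul_zero, zero_add]
  have hxn : sep μ (Vᵀ * (Wᵀ * M * W) * V) * ‖x‖ ≤ specNorm M * ε := by
    refine (sep_mul_norm_le hsep x).trans ?_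
    rw [hCx, hres]
    refine (norm_toEuclideanLin_transpose_le hV _).trans
      ((norm_toEuclideanLin_transpose_le hW _).trans ((norm_toEuclideanLin_apply_le M _).trans ?_))
    rw [hε, norm_sub_rev]
  refine ⟨c, ?_⟩
  have : y - c • Matrix.toEuclideanLin W z = (y - Matrix.toEuclideanLin W u) +
      Matrix.toEuclideanLin W (Matrix.toEuclideanLin V x) := by
    conv_rhs => rw [hc]
    rw [map_add, map_smul]; abel
  rw [this, add_mul, one_mul]
  refine (norm_add_le _ _).trans (add_le_add le_rfl ?_)
  rw [norm_toEuclideanLin_of_transpose_mul_self hW, norm_toEuclideanLin_of_transpose_mul_self hV,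
    div_mul_eq_mul_div, le_div_iff₀ hsep, mul_comm]
  exact hxn

lemma exists_eq_smul_add_of_orthonormal {m : ℕ} {z : EuclideanSpace ℝ κ}
    {w : Fin m → EuclideanSpace ℝ κ} (hz : ‖z‖ = 1) (hw : Orthonormal ℝ w)
    (hzw : ∀ j, inner ℝ z (w j) = (0 : ℝ)) (hcard : Fintype.card κ = m + 1)
    (u : EuclideanSpace ℝ κ) :
    ∃ c : ℝ, u = c • z + Matrix.toEuclideanLin (colMatrix w)
      (Matrix.toEuclideanLin (colMatrix w)ᵀ u) := by
  have hon : Orthonormal ℝ (Fin.cons z w : Fin (m + 1) → EuclideanSpace ℝ κ) := by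
    rw [orthonormal_iff_ite]
    intro i j
    cases i using Fin.cases with
    | zero =>
      cases j using Fin.cases with
      | zero => simp [hz]
      | succ j => simp [hzw, (Fin.succ_ne_zero j).symm]
    | succ i =>
      cases j using Fin.cases with
      | zero => simp [real_inner_comm, hzw, Fin.succ_ne_zero]
      | succ j => simpa using orthonormal_iff_ite.1 hw i j
  have hspan : ⊤ ≤ Submodule.span ℝ (Set.range (Fin.cons z w : Fin (m + 1) → EuclideanSpace ℝ κ)) :=
    (hon.linearIndependent.span_eq_top_of_card_eq_finrank' (by simp [hcard])).ge
  have h := (OrthonormalBasis.mk hon hspan).sum_repr' u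
  rw [Fin.sum_univ_succ] at h
  refine ⟨inner ℝ z u, ?_⟩
  rw [toEuclideanLin_colMatrix_apply]
  conv_lhs => rw [← h]
  simp only [OrthonormalBasis.coe_mk, Fin.cons_zero, Fin.cons_succ]
  congr 1
  refine Finset.sum_congr rfl fun j _ => ?_
  congr 1
  simp [Matrix.toLpLin_apply, Matrix.mulVec, dotProduct, colMatrix, PiLp.inner_apply, mul_comm]

end Perturbation

/-! ### Angles and the consequence of optimality -/

section Angle
variable {E : Type*} [NormedAddCommGroup E] [InnerProductSpace ℝ E]

/-- The right-hand side is smallest when `c • x` is the projection of `y` to the line of `x`. -/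
lemma sin_angle_mul_norm_le {x y : E} (hx : x ≠ 0) (c : ℝ) :
    Real.sin (InnerProductGeometry.angle x y) * ‖y‖ ≤ ‖y - c • x‖ := by
  have h := InnerProductGeometry.sin_angle_mul_norm_mul_norm x y
  have hx0 : 0 < ‖x‖ := norm_pos_iff.2 hx
  refine le_of_mul_le_mul_left ?_ hx0
  have h2 : ‖x‖ * (Real.sin (InnerProductGeometry.angle x y) * ‖y‖) =
    Real.sin (InnerProductGeometry.angle x y) * (‖x‖ * ‖y‖) := by ring
  rw [h2, h, Real.sqrt_le_left (by positivity), mul_pow, norm_sub_sq_real, inner_smul_right,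
    norm_smul, mul_pow, Real.norm_eq_abs, sq_abs, real_inner_self_eq_norm_sq,
    real_inner_self_eq_norm_sq, real_inner_comm x y]
  nlinarith [sq_nonneg (c * ‖x‖ ^ 2 - inner ℝ x y)]

/-- On the sphere of radius `Δ` the objective is `½ ⟪x - s, B (x - s)⟫` up to a constant, so the
constrained minimizer `s'` is at least as close to `s` in the energy norm as the normalization `x`
of `p`. The sine bound `2τ / (1 + τ²)` for `p` means that half the angle between `s` and `p` has
tangent `≤ τ`, whence the chord `‖x - s‖` is at most `2τΔ`. -/
lemma norm_sub_sq_le_of_constrained_min {L B : E →ₗ[ℝ] E} (hL : L.IsSymmetric) {lam : ℝ}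
    (hB : ∀ x, B x = L x + lam • x) {g s s' p : E} {S : Submodule ℝ E} {Δ a b τ : ℝ} (hΔ : 0 < Δ)
    (hb : 0 ≤ b) (hlow : ∀ x, a * ‖x‖ ^ 2 ≤ inner ℝ x (B x))
    (hupp : ∀ x, inner ℝ x (B x) ≤ b * ‖x‖ ^ 2) (hs : B s = -g) (hsΔ : ‖s‖ = Δ)
    (hs'Δ : ‖s'‖ = Δ)
    (hmin : ∀ x ∈ S, ‖x‖ ≤ Δ →
      inner ℝ g s' + (1 / 2) * inner ℝ s' (L s') ≤ inner ℝ g x + (1 / 2) * inner ℝ x (L x))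
    (hτ : 0 < τ) (hτ1 : τ < 1) (hp : p ∈ S) (hsp : ‖s - p‖ ≤ 2 * τ / (1 + τ ^ 2) * ‖s‖) :
    a * ‖s' - s‖ ^ 2 ≤ b * (2 * τ * Δ) ^ 2 := by
  set ζ := (1 - τ ^ 2) / (1 + τ ^ 2) with hζ
  have hτ2 : 0 < 1 - τ ^ 2 := by nlinarith
  have hζ0 : 0 < ζ := by positivity
  have hζ2 : (2 * τ / (1 + τ ^ 2)) ^ 2 = 1 - ζ ^ 2 := by rw [hζ]; field_simp; ring
  have h3 : 2 * (1 - ζ) ≤ 4 * τ ^ 2 := by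
    have : 2 * (1 - ζ) = 4 * τ ^ 2 / (1 + τ ^ 2) := by
      rw [hζ]; field_simp; ring
    rw [this]
    exact div_le_self (by positivity) (by nlinarith)
  clear_value ζ
  have h1 : ‖s - p‖ ^ 2 ≤ (1 - ζ ^ 2) * Δ ^ 2 := by
    rw [← hζ2, ← mul_pow, ← hsΔ]; gcongr
  rw [norm_sub_sq_real, hsΔ] at h1
  have hamgm : ζ * Δ * ‖p‖ ≤ inner ℝ s p := by nlinarith [sq_nonneg (ζ * Δ - ‖p‖)]
  have hp0 : 0 < ‖p‖ := by
    rcases (norm_nonneg p).eq_or_lt with h | h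
    · have hp' : p = 0 := norm_eq_zero.1 h.symm
      rw [hp', inner_zero_right, norm_zero] at h1
      have : 0 < (ζ * Δ) ^ 2 := by positivity
      nlinarith
    · exact h
  set x := (Δ / ‖p‖) • p with hx
  have hxΔ : ‖x‖ = Δ := by
    rw [hx, norm_smul, Real.norm_of_nonneg (by positivity)]; field_simp
  have hxs : ‖x - s‖ ^ 2 ≤ (2 * τ * Δ) ^ 2 := by
    have h2 : ζ * Δ ^ 2 ≤ inner ℝ x s := by
      rw [hx, inner_smul_left, conj_trivial, real_inner_comm, div_mul_eq_mul_div, le_div_iff₀ hp0]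
      nlinarith
    rw [norm_sub_sq_real, hxΔ, hsΔ]
    nlinarith [mul_le_mul_of_nonneg_right h3 (sq_nonneg Δ)]
  have hquad : ∀ v : E, ‖v‖ = Δ → inner ℝ (v - s) (B (v - s)) =
      2 * (inner ℝ g v + (1 / 2) * inner ℝ v (L v)) + lam * Δ ^ 2 + inner ℝ s (B s) := by
    intro v hv
    have hBv : inner ℝ s (B v) = -inner ℝ g v := by
      have : inner ℝ s (B v) = inner ℝ (B s) v := by
        rw [hB, hB, inner_add_left, inner_add_right, hL, inner_smul_left, inner_smul_right]; simp
      rw [this, hs, inner_neg_left]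
    have hvs : inner ℝ v (B s) = -inner ℝ g v := by rw [hs, inner_neg_right, real_inner_comm]
    have hvv : inner ℝ v (B v) = inner ℝ v (L v) + lam * Δ ^ 2 := by
      rw [hB, inner_add_right, inner_smul_right, real_inner_self_eq_norm_sq, hv]
    rw [map_sub, inner_sub_left, inner_sub_right, inner_sub_right, hBv, hvs, hvv]
    ring
  have hopt := hmin x (S.smul_mem _ hp) hxΔ.le
  calc a * ‖s' - s‖ ^ 2 ≤ inner ℝ (s' - s) (B (s' - s)) := hlow _
    _ ≤ inner ℝ (x - s) (B (x - s)) := by rw [hquad _ hs'Δ, hquad _ hxΔ]; linarith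
    _ ≤ b * ‖x - s‖ ^ 2 := hupp _
    _ ≤ _ := by gcongr

lemma LinearMap.IsSymmetric.apply_eq_zero_of_inner_eq_zero {K : E →ₗ[ℝ] E} (hK : K.IsSymmetric)
    (hnn : ∀ x, 0 ≤ inner ℝ x (K x)) {x : E} (hx : inner ℝ x (K x) = 0) : K x = 0 := by
  have h : 0 ≤ -2 * ‖K x‖ ^ 2 := by
    refine nonneg_of_forall_quadratic_nonneg (b := inner ℝ (K x) (K (K x))) (c := 0)
      fun θ hθ _ => ?_
    have h := hnn (x - θ • K x)
    have h1 : inner ℝ x (K (K x)) = ‖K x‖ ^ 2 := by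
      rw [← hK, real_inner_self_eq_norm_sq]
    rw [map_sub, map_smul, inner_sub_left, inner_sub_right, inner_sub_right, hx, inner_smul_left,
      inner_smul_left, inner_smul_right, inner_smul_right, h1, real_inner_self_eq_norm_sq] at h
    simp only [conj_trivial] at h
    have h' : 0 ≤ θ * (-2 * ‖K x‖ ^ 2 + inner ℝ (K x) (K (K x)) * θ) := by linarith
    have := nonneg_of_mul_nonneg_right h' hθ
    linarith
  exact norm_eq_zero.1 (pow_eq_zero_iff two_ne_zero |>.1
    (le_antisymm (by linarith) (by positivity)))
end Angle

/-! ### The projected problem -/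

section Projected
variable {n m : ℕ} {A : Matrix (Fin n) (Fin n) ℝ} {g : EuclideanSpace ℝ (Fin n)} {Δ : ℝ}

lemma mem_span_range_iff_exists_toEuclideanLin_colMatrix {ι κ : Type*} [Fintype ι] [Fintype κ]
    [DecidableEq ι] [DecidableEq κ] {q : κ → EuclideanSpace ℝ ι} {x : EuclideanSpace ℝ ι} :
    x ∈ Submodule.span ℝ (Set.range q) ↔ ∃ u, Matrix.toEuclideanLin (colMatrix q) u = x := by
  rw [Submodule.mem_span_range_iff_exists_fun]
  constructor
  · rintro ⟨c, hc⟩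
    exact ⟨WithLp.toLp 2 c, by rw [toEuclideanLin_colMatrix_apply]; exact hc⟩
  · rintro ⟨u, hu⟩
    exact ⟨u, by rw [← hu, toEuclideanLin_colMatrix_apply]⟩

/-- The projection of the augmented matrix is the augmented matrix of the projected problem. -/
lemma projMatrix_augMatrix_eq {q : Fin m → EuclideanSpace ℝ (Fin n)} (hq : Orthonormal ℝ q) :
    projMatrix (augMatrix A g Δ) q = augMatrix ((colMatrix q)ᵀ * A * colMatrix q)
      (Matrix.toEuclideanLin (colMatrix q)ᵀ g) Δ := by
  have h : (Matrix.toEuclideanLin (colMatrix q)ᵀ g).ofLp = (colMatrix q)ᵀ *ᵥ g.ofLp := rfl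
  rw [projMatrix, augMatrix, augMatrix, Matrix.fromBlocks_transpose, Matrix.fromBlocks_multiply,
    Matrix.fromBlocks_multiply, h]
  simp only [Matrix.transpose_zero, Matrix.zero_mul, Matrix.mul_zero, add_zero, zero_add,
    Matrix.mul_one, Matrix.mul_neg, Matrix.neg_mul, neg_zero, Matrix.zero_mulVec,
    Matrix.zero_vecMulVec, smul_zero, Matrix.mul_smul, Matrix.smul_mul,
    colMatrix_transpose_mul_self hq, Matrix.mul_vecMulVec, Matrix.vecMulVec_mul]
  rw [← Matrix.mulVec_transpose]

lemma isSymm_transpose_mul_mul {ι κ : Type*} [Fintype ι] {A : Matrix ι ι ℝ} (hA : A.IsSymm)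
    (W : Matrix ι κ ℝ) : (Wᵀ * A * W).IsSymm := by
  rw [Matrix.IsSymm, Matrix.transpose_mul, Matrix.transpose_mul, Matrix.transpose_transpose,
    hA.eq, Matrix.mul_assoc]

lemma krylov_power_mem (A : Matrix (Fin n) (Fin n) ℝ) (g : EuclideanSpace ℝ (Fin n)) {j k : ℕ}
    (hj : j ≤ k) : Matrix.toEuclideanLin (A ^ j) g ∈ krylov A g k :=
  Submodule.subset_span ⟨⟨j, Nat.lt_succ_of_le hj⟩, rfl⟩

/-- The projected problem has no hard case: an eigenvector of `Qᵀ A Q` orthogonal to `Qᵀ g` is, by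
induction on the power of `A`, orthogonal to the whole Krylov space. -/
lemma eq_zero_of_projected_eigenvector_orthogonal (hA : A.IsSymm) {k : ℕ}
    {q : Fin m → EuclideanSpace ℝ (Fin n)} (hq : Orthonormal ℝ q)
    (hqspan : Submodule.span ℝ (Set.range q) = krylov A g k) {ν : ℝ}
    {x : EuclideanSpace ℝ (Fin m)}
    (hx : Matrix.toEuclideanLin ((colMatrix q)ᵀ * A * colMatrix q) x = ν • x)
    (hxg : inner ℝ x (Matrix.toEuclideanLin (colMatrix q)ᵀ g) = (0 : ℝ)) : x = 0 := by
  set J := Matrix.toEuclideanLin (colMatrix q) with hJ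
  have hW := colMatrix_transpose_mul_self hq
  have hpow : ∀ j ≤ k, inner ℝ (J x) (Matrix.toEuclideanLin (A ^ j) g) = (0 : ℝ) := by
    intro j
    induction j with
    | zero => intro _; rw [pow_zero, Matrix.toLpLin_one, LinearMap.id_apply, hJ,
        inner_toEuclideanLin_left, hxg]
    | succ j ih =>
      intro hj
      have hmem := krylov_power_mem A g (show j ≤ k by omega)
      rw [← hqspan, mem_span_range_iff_exists_toEuclideanLin_colMatrix] at hmem
      obtain ⟨u, hu⟩ := hmem
      rw [pow_succ', toEuclideanLin_mul_apply, ← isSymmetric_toEuclideanLin hA (J x), ← hu,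
        real_inner_comm, inner_toEuclideanLin_left, hJ, ← toEuclideanLin_mul_apply,
        ← toEuclideanLin_mul_apply, hx, inner_smul_right, real_inner_comm]
      have h0 := ih (by omega)
      rw [← hu, real_inner_comm, inner_toEuclideanLin_left, hJ, ← toEuclideanLin_mul_apply, hW,
        Matrix.toLpLin_one, LinearMap.id_apply, real_inner_comm] at h0
      rw [h0, mul_zero]
  have hself : inner ℝ (J x) (J x) = (0 : ℝ) := by
    have hmem : J x ∈ krylov A g k := by
      rw [← hqspan, mem_span_range_iff_exists_toEuclideanLin_colMatrix]; exact ⟨x, rfl⟩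
    have hle : krylov A g k ≤ LinearMap.ker (innerₛₗ ℝ (J x)) := by
      rw [krylov, Submodule.span_le]
      rintro _ ⟨i, rfl⟩
      simpa using hpow i (Nat.le_of_lt_succ i.2)
    simpa using hle hmem
  rw [real_inner_self_eq_norm_sq, hJ, norm_toEuclideanLin_of_transpose_mul_self hW] at hself
  exact norm_eq_zero.1 (pow_eq_zero_iff two_ne_zero |>.1 hself)

/-- Because the hard case does not occur, the shifted projected matrix is even positive definite. -/
lemma exists_projected_multiplier (hA : A.IsSymm) (hΔ : 0 < Δ) {k : ℕ}
    {q : Fin m → EuclideanSpace ℝ (Fin n)} (hq : Orthonormal ℝ q)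
    (hqspan : Submodule.span ℝ (Set.range q) = krylov A g k)
    {u : EuclideanSpace ℝ (Fin m)}
    (hu : IsTRSSolution A g Δ (krylov A g k) (Matrix.toEuclideanLin (colMatrix q) u))
    (huΔ : ‖u‖ = Δ) :
    ∃ lam : ℝ, Matrix.toEuclideanLin ((colMatrix q)ᵀ * A * colMatrix q +
        lam • (1 : Matrix (Fin m) (Fin m) ℝ)) u = -Matrix.toEuclideanLin (colMatrix q)ᵀ g ∧
      ∀ x : EuclideanSpace ℝ (Fin m), x ≠ 0 → 0 < inner ℝ x (Matrix.toEuclideanLin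
        ((colMatrix q)ᵀ * A * colMatrix q + lam • (1 : Matrix (Fin m) (Fin m) ℝ)) x) := by
  have hW := colMatrix_transpose_mul_self hq
  have hT := isSymm_transpose_mul_mul hA (colMatrix q)
  have hobj : ∀ x, trsObjective A g (Matrix.toEuclideanLin (colMatrix q) x) =
      inner ℝ (Matrix.toEuclideanLin (colMatrix q)ᵀ g) x + (1 / 2) *
        inner ℝ x (Matrix.toEuclideanLin ((colMatrix q)ᵀ * A * colMatrix q) x) := by
    intro x
    rw [trsObjective, real_inner_comm, inner_toEuclideanLin_left, inner_toEuclideanLin_left,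
      ← toEuclideanLin_mul_apply, ← toEuclideanLin_mul_apply, real_inner_comm]
  obtain ⟨lam, hlam, hstat, hnn⟩ := exists_multiplier_of_isMin (isSymmetric_toEuclideanLin hT) hΔ
    huΔ (g := Matrix.toEuclideanLin (colMatrix q)ᵀ g) (fun x hx => by
      rw [← hobj, ← hobj]
      refine hu.2.2 _ ?_ ?_
      · rw [← hqspan, mem_span_range_iff_exists_toEuclideanLin_colMatrix]; exact ⟨x, rfl⟩
      · rwa [norm_toEuclideanLin_of_transpose_mul_self hW])
  have hK := isSymmetric_toEuclideanLin (isSymm_add_smul_one hT lam)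
  refine ⟨lam, ?_, fun x hx => ?_⟩
  · rw [toEuclideanLin_add_smul_one_apply, hstat]
  · refine lt_of_le_of_ne ?_ fun h0 => hx ?_
    · rw [toEuclideanLin_add_smul_one_apply]; exact hnn x
    · have hKx := hK.apply_eq_zero_of_inner_eq_zero
        (fun y => by rw [toEuclideanLin_add_smul_one_apply]; exact hnn y) h0.symm
      have hxg : inner ℝ x (Matrix.toEuclideanLin (colMatrix q)ᵀ g) = (0 : ℝ) := by
        have h1 := hK x u
        rw [hKx, inner_zero_left, toEuclideanLin_add_smul_one_apply, hstat, inner_neg_right] at h1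
        linarith
      refine eq_zero_of_projected_eigenvector_orthogonal hA hq hqspan (ν := -lam) ?_ hxg
      rw [toEuclideanLin_add_smul_one_apply] at hKx
      rw [neg_smul]
      exact eq_neg_of_add_eq_zero_left hKx

end Projected

/-! ### The easy case -/

section EasyCase
variable {n : ℕ} {A : Matrix (Fin n) (Fin n) ℝ} {g : EuclideanSpace ℝ (Fin n)} {Δ : ℝ}

lemma add_multiplier_pos_of_not_hardCase (hA : A.IsSymm) {αmin : ℝ}
    (hαmin : αmin ∈ spectrum ℝ A)
    {s : EuclideanSpace ℝ (Fin n)} {lam : ℝ} (hlam : IsOptimalMultiplier A g Δ s lam)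
    (heasy : ¬ HardCase A g αmin lam) : 0 < αmin + lam := by
  have hB := isSymmetric_toEuclideanLin (isSymm_add_smul_one hA lam)
  refine lt_of_le_of_ne ?_ fun h0 => heasy ⟨fun v hv => ?_, by linarith⟩
  · obtain ⟨v, hv⟩ := (hasEigenvalue_toEuclideanLin_iff_mem_spectrum.2 hαmin).exists_hasEigenvector
    have h := (Matrix.isPositive_toEuclideanLin_iff.2 hlam.2.2.2).inner_nonneg_right v
    rw [toEuclideanLin_add_smul_one_apply, hv.apply_eq_smul, ← add_smul, inner_smul_right,
      real_inner_self_eq_norm_sq] at h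
    exact nonneg_of_mul_nonneg_left h (by have := norm_pos_iff.2 hv.2; positivity)
  · have hBv : Matrix.toEuclideanLin (A + lam • (1 : Matrix (Fin n) (Fin n) ℝ)) v = 0 := by
      rw [toEuclideanLin_add_smul_one_apply, hv, ← add_smul, ← h0, zero_smul]
    have h := hB s v
    rw [hBv, inner_zero_right, hlam.2.1, inner_neg_left] at h
    linarith

lemma sub_mem_spectrum_of_hasEigenvalue_add {lam ν : ℝ}
    (h : Module.End.HasEigenvalue
      (Matrix.toEuclideanLin (A + lam • (1 : Matrix (Fin n) (Fin n) ℝ))) ν) :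
    ν - lam ∈ spectrum ℝ A := by
  obtain ⟨v, hv⟩ := h.exists_hasEigenvector
  rw [← hasEigenvalue_toEuclideanLin_iff_mem_spectrum]
  refine Module.End.hasEigenvalue_of_hasEigenvector (x := v)
    ⟨Module.End.mem_eigenspace_iff.2 ?_, hv.2⟩
  have h1 := hv.apply_eq_smul
  rw [toEuclideanLin_add_smul_one_apply] at h1
  rw [sub_smul, ← h1]; abel

end EasyCase

/-- With the rate `t` of an interval `[a, b]` the endpoints are `w (1 - t)²` and `w (1 + t)²`. -/
lemma trsRate_parametrization {a b t w : ℝ} (ha : 0 < a) (hab : a < b)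
    (ht : t = (√(b / a) - 1) / (√(b / a) + 1)) (hw : w = a / (1 - t) ^ 2) :
    0 < t ∧ t < 1 ∧ 0 < w ∧ a = w * (1 - t) ^ 2 ∧ b = w * (1 + t) ^ 2 := by
  set r := √(b / a) with hr
  have hr1 : 1 < r := by
    rw [hr, Real.lt_sqrt zero_le_one, one_pow]
    exact (one_lt_div ha).2 hab
  have hr2 : r ^ 2 = b / a := Real.sq_sqrt (by have := ha.trans hab; positivity)
  have ht0 : 0 < t := by rw [ht]; exact div_pos (by linarith) (by linarith)
  have ht1 : t < 1 := by rw [ht, div_lt_one (by linarith)]; linarith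
  have h1t : 0 < 1 - t := by linarith
  refine ⟨ht0, ht1, by rw [hw]; positivity, by rw [hw]; field_simp, ?_⟩
  have hrt : r = (1 + t) / (1 - t) := by
    rw [eq_div_iff h1t.ne', ht]; field_simp; ring
  rw [hw, div_mul_eq_mul_div, mul_div_assoc, ← div_pow, ← hrt, hr2]
  field_simp

/-! ### Assembly of the bounds -/

lemma sinAngleSubspace_lt_one {ι : Type*} [Fintype ι] {y d : EuclideanSpace ℝ ι}
    {D : Submodule ℝ (EuclideanSpace ℝ ι)} (hd : d ∈ D) (hdy : inner ℝ d y ≠ 0) :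
    sinAngleSubspace y D < 1 := by
  have hy : 0 < ‖y‖ := norm_pos_iff.2 (by rintro rfl; simp at hdy)
  have hP : 0 < ‖D.starProjection y‖ := by
    refine norm_pos_iff.2 fun h => hdy ?_
    rw [Submodule.starProjection_apply_eq_zero_iff] at h
    exact h d hd
  rw [sinAngleSubspace, div_lt_one hy]
  refine lt_of_pow_lt_pow_left₀ 2 hy.le ?_
  rw [D.norm_sq_eq_add_norm_sq_starProjection y, Submodule.starProjection_orthogonal_val]
  nlinarith

lemma blockDiag_transpose_mul_self {ι κ : Type*} [Fintype ι] [DecidableEq κ]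
    {W : Matrix ι κ ℝ} (hW : Wᵀ * W = 1) :
    (Matrix.fromBlocks W 0 0 W)ᵀ * Matrix.fromBlocks W 0 0 W = 1 := by
  rw [Matrix.fromBlocks_transpose, Matrix.fromBlocks_multiply]
  simp [hW]

lemma norm_upperPart_le {ι : Type*} [Fintype ι] (x : EuclideanSpace ℝ (ι ⊕ ι)) :
    ‖upperPart x‖ ≤ ‖x‖ := by
  refine le_of_sq_le_sq ?_ (norm_nonneg _)
  rw [norm_sq_eq_norm_sq_parts x]
  nlinarith [sq_nonneg ‖lowerPart x‖]

lemma norm_sub_blockDiag_projection_le {ι κ : Type*} [Fintype ι] [Fintype κ] [DecidableEq ι]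
    [DecidableEq κ] {W : Matrix ι κ ℝ} (hW : Wᵀ * W = 1) {y : EuclideanSpace ℝ (ι ⊕ ι)}
    {c α β : ℝ} {s v : EuclideanSpace ℝ ι} (hy₁ : upperPart y = c • s) (hy₂ : lowerPart y = c • v)
    {u₁ u₂ : EuclideanSpace ℝ κ} (h₁ : ‖s - Matrix.toEuclideanLin W u₁‖ ≤ α)
    (h₂ : ‖v - Matrix.toEuclideanLin W u₂‖ ≤ β) :
    ‖y - Matrix.toEuclideanLin (Matrix.fromBlocks W 0 0 W)
      (Matrix.toEuclideanLin (Matrix.fromBlocks W 0 0 W)ᵀ y)‖ ≤ |c| * √(α ^ 2 + β ^ 2) := by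
  refine (norm_sub_projection_le (blockDiag_transpose_mul_self hW) y
    (joinParts (c • u₁) (c • u₂))).trans ?_
  rw [toEuclideanLin_blockDiag_apply, upperPart_joinParts, lowerPart_joinParts]
  refine le_of_sq_le_sq ?_ (by positivity)
  rw [norm_sq_eq_norm_sq_parts]
  have e₁ : upperPart (y - joinParts (Matrix.toEuclideanLin W (c • u₁))
      (Matrix.toEuclideanLin W (c • u₂))) = c • (s - Matrix.toEuclideanLin W u₁) := by
    change upperPart y - Matrix.toEuclideanLin W (c • u₁) = _
    rw [hy₁, map_smul, smul_sub]
  have e₂ : lowerPart (y - joinParts (Matrix.toEuclideanLin W (c • u₁))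
      (Matrix.toEuclideanLin W (c • u₂))) = c • (v - Matrix.toEuclideanLin W u₂) := by
    change lowerPart y - Matrix.toEuclideanLin W (c • u₂) = _
    rw [hy₂, map_smul, smul_sub]
  rw [e₁, e₂, norm_smul, norm_smul, Real.norm_eq_abs, mul_pow, mul_pow, mul_pow,
    Real.sq_sqrt (by positivity), mul_add]
  gcongr

lemma abs_mul_sin_angle_mul_norm_le {ι κ : Type*} [Fintype ι] [Fintype κ] [DecidableEq ι]
    [DecidableEq κ] {W : Matrix ι κ ℝ} {y : EuclideanSpace ℝ (ι ⊕ ι)}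
    {z : EuclideanSpace ℝ (κ ⊕ κ)} {c c' : ℝ} {s s' : EuclideanSpace ℝ ι}
    {u : EuclideanSpace ℝ κ} (hc : c ≠ 0) (hy : upperPart y = c • s) (hz : upperPart z = c' • u)
    (hu : Matrix.toEuclideanLin W u = s') (hs' : s' ≠ 0) (γ : ℝ) :
    |c| * (Real.sin (InnerProductGeometry.angle s' s) * ‖s‖) ≤
      ‖y - γ • Matrix.toEuclideanLin (Matrix.fromBlocks W 0 0 W) z‖ := by
  refine le_trans ?_ (norm_upperPart_le _)
  have e : upperPart (y - γ • Matrix.toEuclideanLin (Matrix.fromBlocks W 0 0 W) z) =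
      c • (s - (c⁻¹ * (γ * c')) • s') := by
    rw [toEuclideanLin_blockDiag_apply]
    change upperPart y - γ • Matrix.toEuclideanLin W (upperPart z) = _
    rw [hy, hz, map_smul, hu, smul_sub, smul_smul, smul_smul, mul_inv_cancel_left₀ hc]
  rw [e, norm_smul, Real.norm_eq_abs]
  gcongr
  exact sin_angle_mul_norm_le hs' _

/-- The bound that uses only the optimality of the approximate solution: it loses the factor
`√κ = (1 + t) / (1 - t)` against the best approximation of `s` from `S`. -/
lemma sin_angle_le_of_constrained_min {E : Type*} [NormedAddCommGroup E] [InnerProductSpace ℝ E]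
    [FiniteDimensional ℝ E] {L B : E →ₗ[ℝ] E} (hL : L.IsSymmetric) (hBs : B.IsSymmetric) {lam : ℝ}
    (hB : ∀ x, B x = L x + lam • x) {g s s' p : E} {S : Submodule ℝ E} {Δ t w τ : ℝ} (hΔ : 0 < Δ)
    (ht : 0 < t) (ht1 : t < 1) (hw : 0 < w)
    (hlow : ∀ ν, Module.End.HasEigenvalue B ν → w * (1 - t) ^ 2 ≤ ν)
    (hupp : ∀ ν, Module.End.HasEigenvalue B ν → ν ≤ w * (1 + t) ^ 2)
    (hs : B s = -g) (hsΔ : ‖s‖ = Δ) (hs'Δ : ‖s'‖ = Δ)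
    (hmin : ∀ x ∈ S, ‖x‖ ≤ Δ →
      inner ℝ g s' + (1 / 2) * inner ℝ s' (L s') ≤ inner ℝ g x + (1 / 2) * inner ℝ x (L x))
    (hτ : 0 < τ) (hτ1 : τ < 1) (hp : p ∈ S) (hsp : ‖s - p‖ ≤ 2 * τ / (1 + τ ^ 2) * ‖s‖) :
    Real.sin (InnerProductGeometry.angle s' s) ≤ 2 * ((1 + t) / (1 - t)) * τ := by
  have h1t : 0 < 1 - t := by linarith
  have h := norm_sub_sq_le_of_constrained_min hL hB hΔ (by positivity)
    (hBs.mul_norm_sq_le_inner hlow) (hBs.inner_le_mul_norm_sq hupp) hs hsΔ hs'Δ hmin hτ hτ1 hp hsp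
  have h' : ((1 - t) * ‖s' - s‖) ^ 2 ≤ ((1 + t) * (2 * τ * Δ)) ^ 2 := by
    refine le_of_mul_le_mul_left ?_ hw
    linarith
  have h2 := le_of_sq_le_sq h' (by positivity)
  have h3 := sin_angle_mul_norm_le (y := s) (norm_pos_iff.1 (by rw [hs'Δ]; exact hΔ) : s' ≠ 0) 1
  rw [one_smul, norm_sub_rev, hsΔ] at h3
  refine le_of_mul_le_mul_right ?_ hΔ
  have h4 : 2 * ((1 + t) / (1 - t)) * τ * Δ = (1 + t) * (2 * τ * Δ) / (1 - t) := by ring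
  rw [h4, le_div_iff₀ h1t]
  nlinarith

lemma exists_upperPart_projected_eigenvector {n : ℕ} {A : Matrix (Fin n) (Fin n) ℝ}
    {g : EuclideanSpace ℝ (Fin n)} {Δ : ℝ} (hA : A.IsSymm) (hΔ : 0 < Δ) {k m : ℕ}
    {q : Fin m → EuclideanSpace ℝ (Fin n)} (hq : Orthonormal ℝ q)
    (hqspan : Submodule.span ℝ (Set.range q) = krylov A g k)
    {s : EuclideanSpace ℝ (Fin n)} (hs : IsTRSSolution A g Δ (krylov A g k) s) (hsΔ : ‖s‖ = Δ)
    {ν : ℝ} (hν : IsRightmostEigenvalue (projMatrix (augMatrix A g Δ) q) ν)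
    {z : EuclideanSpace ℝ (Fin m ⊕ Fin m)}
    (hz : IsUnitEigenvector (projMatrix (augMatrix A g Δ) q) ν z) :
    ∃ (u : EuclideanSpace ℝ (Fin m)) (c : ℝ),
      Matrix.toEuclideanLin (colMatrix q) u = s ∧ upperPart z = c • u := by
  obtain ⟨u, hu⟩ : ∃ u, Matrix.toEuclideanLin (colMatrix q) u = s := by
    rw [← mem_span_range_iff_exists_toEuclideanLin_colMatrix, hqspan]; exact hs.1
  have huΔ : ‖u‖ = Δ := by
    rw [← norm_toEuclideanLin_of_transpose_mul_self (colMatrix_transpose_mul_self hq), hu, hsΔ]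
  obtain ⟨lam, hstat, hpos⟩ :=
    exists_projected_multiplier hA hΔ hq hqspan (u := u) (by rw [hu]; exact hs) huΔ
  rw [projMatrix_augMatrix_eq hq] at hν hz
  obtain ⟨c, -, hz₁, -⟩ := augMatrix_rightmost_eigenvector (isSymm_transpose_mul_mul hA _) hΔ
    hpos hstat huΔ hν hz
  exact ⟨u, c, hu, hz₁⟩

/-- The bound from the perturbation of the eigenvector `y = c (s, v)`: the upper block of the Ritz
vector is a multiple of `s'`, and the factor `|c| Δ`, the norm of the upper block of `y`, cancels. -/
lemma sin_angle_le_of_ritzVector {ι κ : Type*} [Fintype ι] [Fintype κ] [DecidableEq ι]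
    [DecidableEq κ] {W : Matrix ι κ ℝ} (hW : Wᵀ * W = 1) {y : EuclideanSpace ℝ (ι ⊕ ι)}
    {z : EuclideanSpace ℝ (κ ⊕ κ)} {c c' Δ τ X F γ : ℝ} {s s' v : EuclideanSpace ℝ ι}
    {u u₁ u₂ : EuclideanSpace ℝ κ} (hΔ : 0 < Δ) (hτ : 0 < τ) (hF : 0 ≤ F) (hc : c ≠ 0)
    (hsΔ : ‖s‖ = Δ) (hs' : s' ≠ 0) (hy₁ : upperPart y = c • s) (hy₂ : lowerPart y = c • v)
    (hz : upperPart z = c' • u) (hu : Matrix.toEuclideanLin W u = s')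
    (h₁ : ‖s - Matrix.toEuclideanLin W u₁‖ ≤ 2 * τ * Δ)
    (h₂ : ‖v - Matrix.toEuclideanLin W u₂‖ ≤ X * τ * Δ)
    (hγ : ‖y - γ • Matrix.toEuclideanLin (Matrix.fromBlocks W 0 0 W) z‖ ≤
      F * ‖y - Matrix.toEuclideanLin (Matrix.fromBlocks W 0 0 W)
        (Matrix.toEuclideanLin (Matrix.fromBlocks W 0 0 W)ᵀ y)‖) :
    Real.sin (InnerProductGeometry.angle s' s) ≤ F * √(4 + X ^ 2) * τ := by
  have hε := norm_sub_blockDiag_projection_le hW hy₁ hy₂ h₁ h₂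
  have hsqrt : √((2 * τ * Δ) ^ 2 + (X * τ * Δ) ^ 2) = √(4 + X ^ 2) * (τ * Δ) := by
    have : (2 * τ * Δ) ^ 2 + (X * τ * Δ) ^ 2 = (4 + X ^ 2) * (τ * Δ) ^ 2 := by ring
    rw [this, Real.sqrt_mul (by positivity), Real.sqrt_sq (by positivity)]
  rw [hsqrt] at hε
  have hup := abs_mul_sin_angle_mul_norm_le hc hy₁ hz hu hs' γ
  rw [hsΔ] at hup
  have hcΔ : 0 < |c| * Δ := mul_pos (abs_pos.2 hc) hΔ
  refine le_of_mul_le_mul_right ?_ hcΔ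
  calc _ = |c| * (Real.sin (InnerProductGeometry.angle s' s) * Δ) := by ring
    _ ≤ F * (|c| * (√(4 + X ^ 2) * (τ * Δ))) :=
      hup.trans (hγ.trans (mul_le_mul_of_nonneg_left hε hF))
    _ = _ := by ring

lemma trsFactor_eq {αmax αmin lam t w : ℝ} {k : ℕ} (ht : t = trsRate αmax αmin lam) (ht0 : 0 < t)
    (ht1 : t < 1) (hw : 0 < w) (ha : αmin + lam = w * (1 - t) ^ 2)
    (hb : αmax + lam = w * (1 + t) ^ 2) :
    trsFactor αmax αmin lam k = 2 + 1 / w * ((1 + t) / (1 - t)) *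
      (1 + ((k + 1 : ℝ) + 1) / -Real.log t) := by
  have h1t : 0 < 1 - t := by linarith
  have hd : αmax - αmin = 4 * t * w := by linarith
  have h2 : 1 - t ^ 2 = (1 - t) * (1 + t) := by ring
  rw [trsFactor, ← ht, hd, hb, abs_of_neg (Real.log_neg ht0 ht1), h2,
    show (k : ℝ) + 2 = k + 1 + 1 by ring]
  generalize (1 + ((k : ℝ) + 1 + 1) / -Real.log t) = c
  field_simp
  ring

theorem theorem5p3 {n : ℕ} (A : Matrix (Fin n) (Fin n) ℝ) (hA : A.IsSymm) (hAdet : A.det ≠ 0)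
    (g : EuclideanSpace ℝ (Fin n)) (hg : g ≠ 0) (Δ : ℝ) (hΔ : 0 < Δ)
    -- the largest and the smallest eigenvalue of `A`
    (αmax αmin : ℝ) (hαmax : IsGreatest (spectrum ℝ A) αmax) (hαmin : IsLeast (spectrum ℝ A) αmin)
    (hα : αmin < αmax)
    -- the solution and its multiplier, in the easy case and on the boundary
    (sopt : EuclideanSpace ℝ (Fin n)) (lam : ℝ)
    (hsopt : IsTRSSolution A g Δ ⊤ sopt) (hlam : IsOptimalMultiplier A g Δ sopt lam)
    (heasy : ¬ HardCase A g αmin lam) (hsoptΔ : ‖sopt‖ = Δ)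
    -- the `k`-th approximate solution, and an orthonormal basis of the `k + 1` dimensional
    -- Krylov subspace
    (k : ℕ) (q : Fin (k + 1) → EuclideanSpace ℝ (Fin n)) (hq : Orthonormal ℝ q)
    (hqspan : Submodule.span ℝ (Set.range q) = krylov A g k)
    (sk : EuclideanSpace ℝ (Fin n)) (hsk : IsTRSSolution A g Δ (krylov A g k) sk)
    (hskΔ : ‖sk‖ = Δ)
    -- the rightmost eigenpair of `M`
    (μ : ℝ) (hμ : IsRightmostEigenvalue (augMatrix A g Δ) μ)
    (y : EuclideanSpace ℝ (Fin n ⊕ Fin n)) (hy : IsUnitEigenvector (augMatrix A g Δ) μ y)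
    -- the rightmost eigenpair of `M_k`, and an orthonormal basis `w` of the orthogonal complement
    -- of its eigenvector
    (μk : ℝ) (hμk : IsRightmostEigenvalue (projMatrix (augMatrix A g Δ) q) μk)
    (z : EuclideanSpace ℝ (Fin (k + 1) ⊕ Fin (k + 1)))
    (hz : IsUnitEigenvector (projMatrix (augMatrix A g Δ) q) μk z)
    (w : Fin (2 * k + 1) → EuclideanSpace ℝ (Fin (k + 1) ⊕ Fin (k + 1))) (hw : Orthonormal ℝ w)
    (hzw : ∀ j, inner ℝ z (w j) = (0 : ℝ))
    -- the separation of `μ` and `C_k`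
    (hsep : 0 < sep μ (compression (projMatrix (augMatrix A g Δ) q) w)) :
    Real.sin (InnerProductGeometry.angle sk sopt) ≤
      trsFactor αmax αmin lam k *
        (1 + specNorm (augMatrix A g Δ) /
          (Real.sqrt (1 - sinAngleSubspace y (doubledSubspace (krylov A g k)) ^ 2) *
            sep μ (compression (projMatrix (augMatrix A g Δ) q) w))) *
        trsRate αmax αmin lam ^ (k + 1) := by
  -- spectrum of the shifted matrix, parametrized by the rate `t`
  have ha : 0 < αmin + lam := add_multiplier_pos_of_not_hardCase hA hαmin.1 hlam heasy
  set t := trsRate αmax αmin lam with ht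
  obtain ⟨ω, hω⟩ : ∃ ω : ℝ, ω = (αmin + lam) / (1 - t) ^ 2 := ⟨_, rfl⟩
  obtain ⟨ht0, ht1, hω0, haω, hbω⟩ := trsRate_parametrization ha (by linarith) ht hω
  have h1t : 0 < 1 - t := by linarith
  set B := Matrix.toEuclideanLin (A + lam • (1 : Matrix (Fin n) (Fin n) ℝ)) with hBdef
  have hB : B.IsSymmetric := isSymmetric_toEuclideanLin (isSymm_add_smul_one hA lam)
  have hlow : ∀ ν, Module.End.HasEigenvalue B ν → ω * (1 - t) ^ 2 ≤ ν := fun ν hν => by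
    have := hαmin.2 (sub_mem_spectrum_of_hasEigenvalue_add hν)
    linarith
  have hupp : ∀ ν, Module.End.HasEigenvalue B ν → ν ≤ ω * (1 + t) ^ 2 := fun ν hν => by
    have := hαmax.2 (sub_mem_spectrum_of_hasEigenvalue_add hν)
    linarith
  have hposB : ∀ x, x ≠ 0 → 0 < inner ℝ x (B x) := fun x hx =>
    lt_of_lt_of_le (by have := norm_pos_iff.2 hx; positivity) (hB.mul_norm_sq_le_inner hlow x)
  -- the two rightmost eigenvectors
  obtain ⟨c, hc, hy1, hBy2⟩ :=
    augMatrix_rightmost_eigenvector hA hΔ hposB hlam.2.1 hsoptΔ hμ hy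
  have hW := colMatrix_transpose_mul_self hq
  obtain ⟨u, c', hu, hz1⟩ :=
    exists_upperPart_projected_eigenvector hA hΔ hq hqspan hsk hskΔ hμk hz
  -- polynomial approximation from the Krylov subspace
  have hBv : B (c⁻¹ • lowerPart y) = sopt := by
    rw [map_smul, hBy2, hy1, smul_smul, inv_mul_cancel₀ hc, one_smul]
  set v := c⁻¹ • lowerPart y with hv
  have hy2 : lowerPart y = c • v := by rw [hv, smul_smul, mul_inv_cancel₀ hc, one_smul]
  obtain ⟨⟨x₁, hx₁S, hx₁⟩, x₂, hx₂S, hx₂⟩ := exists_krylov_approx (S := krylov A g k) (k := k)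
    hB ht0 ht1 hω0 hlow hupp (aeval_toEuclideanLin_mem_krylov A g k lam) hlam.2.1 hBv
  set τ := t ^ (k + 1) with hτ
  have hτ0 : 0 < τ := by positivity
  have hτ1 : τ < 1 := pow_lt_one₀ ht0.le ht1 (by omega)
  set X := 2 / ω * (1 / (1 - t) ^ 2 + (k + 1) / (1 - t ^ 2)) with hX
  set σ := Real.sin (InnerProductGeometry.angle sk sopt) with hσ
  have hsk0 : sk ≠ 0 := norm_pos_iff.1 (by rw [hskΔ]; exact hΔ)
  -- bound from the optimality of `sk`
  have hσ1 : σ ≤ 2 * ((1 + t) / (1 - t)) * τ :=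
    sin_angle_le_of_constrained_min (isSymmetric_toEuclideanLin hA) hB
      (toEuclideanLin_add_smul_one_apply A lam) hΔ ht0 ht1 hω0 hlow hupp hlam.2.1 hsoptΔ hskΔ
      hsk.2.2 hτ0 hτ1 hx₁S hx₁
  -- bound from the perturbation of the eigenvector
  set W := Matrix.fromBlocks (colMatrix q) 0 0 (colMatrix q) with hWdef
  have hWW : Wᵀ * W = 1 := blockDiag_transpose_mul_self hW
  have hV := colMatrix_transpose_mul_self hw
  have hVz : Matrix.toEuclideanLin (colMatrix w)ᵀ z = 0 := by
    ext j
    rw [PiLp.zero_apply, ← hzw j]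
    simp [Matrix.toLpLin_apply, Matrix.mulVec, dotProduct, colMatrix, PiLp.inner_apply]
  have hdec := exists_eq_smul_add_of_orthonormal hz.2 hw hzw (by simp; omega)
  set δ := sep μ (compression (projMatrix (augMatrix A g Δ) q) w) with hδ
  have hδ2 : δ ≤ 2 * specNorm (augMatrix A g Δ) := sep_compression_le hWW hV hy hsep
  obtain ⟨γ, hγ⟩ := exists_norm_sub_smul_ritzVector_le hWW hV hy.1 hz.1 hVz hdec hsep
  change _ ≤ (1 + specNorm (augMatrix A g Δ) / δ) * _ at hγ
  set F₁ := 1 + specNorm (augMatrix A g Δ) / δ with hF₁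
  have hF₁2 : 3 / 2 ≤ F₁ := by
    have : 1 / 2 ≤ specNorm (augMatrix A g Δ) / δ := by rw [le_div_iff₀ hsep]; linarith
    rw [hF₁]; linarith
  have hσ2 : σ ≤ F₁ * √(4 + X ^ 2) * τ := by
    rw [← hqspan, mem_span_range_iff_exists_toEuclideanLin_colMatrix] at hx₁S hx₂S
    obtain ⟨u₁, rfl⟩ := hx₁S
    obtain ⟨u₂, rfl⟩ := hx₂S
    rw [hsoptΔ] at hx₁ hx₂
    refine sin_angle_le_of_ritzVector hW hΔ hτ0 (by linarith) hc hsoptΔ hsk0 hy1 hy2 hz1 hu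
      (hx₁.trans ?_) hx₂ hγ
    refine mul_le_mul_of_nonneg_right (div_le_self (by positivity) ?_) hΔ.le
    linarith [sq_nonneg τ]
  -- `y` is not orthogonal to `(g, 0)`, so `ε < 1` and the division by `√(1 - ε²)` is genuine
  set ε := sinAngleSubspace y (doubledSubspace (krylov A g k)) with hε
  have hε0 : 0 ≤ ε := by rw [hε, sinAngleSubspace]; positivity
  have hε1 : ε < 1 := by
    refine sinAngleSubspace_lt_one (d := joinParts g 0) ⟨?_, (krylov A g k).zero_mem⟩ ?_
    · have := krylov_power_mem A g (Nat.zero_le k)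
      rwa [pow_zero, Matrix.toLpLin_one] at this
    · rw [inner_eq_inner_parts, upperPart_joinParts, lowerPart_joinParts, inner_zero_left, add_zero,
        hy1, inner_smul_right, ← neg_neg g, ← hlam.2.1, inner_neg_left, real_inner_comm]
      exact mul_ne_zero hc (neg_ne_zero.2 (hposB _ (norm_pos_iff.1 (by rw [hsoptΔ]; exact hΔ))).ne')
  have hsq0 : 0 < √(1 - ε ^ 2) :=
    Real.sqrt_pos.2 (sub_pos.2 (pow_lt_one₀ hε0 hε1 two_ne_zero))
  have hsq1 : √(1 - ε ^ 2) ≤ 1 := Real.sqrt_le_one.2 (sub_le_self _ (sq_nonneg ε))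
  have hF : F₁ ≤ 1 + specNorm (augMatrix A g Δ) / (√(1 - ε ^ 2) * δ) := by
    rw [hF₁]
    have : 0 ≤ specNorm (augMatrix A g Δ) := norm_nonneg _
    gcongr
    exact mul_le_of_le_one_left hsep.le hsq1
  rw [trsFactor_eq ht ht0 ht1 hω0 haω hbω]
  refine combine_bounds (X := X) ht0 ht1 hω0 (neg_pos.2 (Real.log_neg ht0 ht1))
    (neg_log_mul_sqrt_le ht0 ht1) (by linarith [(Nat.cast_nonneg k : (0 : ℝ) ≤ k)]) hX rfl
    (hF₁2.trans hF) hτ0 hσ1 (hσ2.trans ?_)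
  gcongr
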